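/- Let $\mathcal C$ be a cocomplete locally small category, let $\mathbb J$ be a small (strict) double category, and let $U : \mathbb J \to \mathbf{Sq}(\mathcal C)$ be a double functor to the double category of commutative squares in $\mathcal C$ (objects and horizontal arrows: those of $\mathcal C$; vertical arrows: the morphisms of $\mathcal C$; squares: commutative squares). Suppose that for each object $A$ of $\mathbb J$ the object $UA$ is $\omega$-small, that is, $\mathcal C(UA,-) : \mathcal C \to \mathbf{Set}$ preserves colimits of $\omega$-chains. Then the algebraic weak factorisation system cofibrantly generated by $\mathbb J$ exists: there is an algebraic weak factorisation system $(L,R)$ on $\mathcal C$ together with an isomorphism $\mathsf R\text{-}\mathbb{A}\mathbf{lg} \cong \mathbb J^{\pitchfork\!\!\pitchfork}$ of double categories over $\mathbf{Sq}(\mathcal C)$. Here an algebraic weak factorisation system is a functorial factorisation $f = Rf\circ Lf$ on $\mathcal C$, an extension of the copointed endofunctor $L$ (with counit $(1,Rf) : Lf \to f$) to a comonad on $\mathcal C^{\mathbf 2}$ and of the pointed endofunctor $R$ (with unit $(Lf,1) : f \to Rf$) to a monad on $\mathcal C^{\mathbf 2}$, such that the transformation $LR \Rightarrow RL$ whose components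 are formed from the comultiplication and the multiplication is a distributive law. The double category $\mathsf R\text{-}\mathbb{A}\mathbf{lg}$ has the objects and arrows of $\mathcal C$ as objects and horizontal arrows, the $R$-algebras as vertical arrows, with their canonical vertical composition, and the morphisms of $R$-algebras as squares. The double category $\mathbb J^{\pitchfork\!\!\pitchfork}$ has the objects and arrows of $\mathcal C$ as objects and horizontal arrows; a vertical arrow $X \to Y$ is a morphism $f : X \to Y$ with an operation $\varphi$ assigning to each vertical $j : A \to B$ of $\mathbb J$ and each commutative square $(u,v) : Uj \to f$ a diagonal filler $\varphi_j(u,v) : UB \to X$, such that $\varphi_i(u\circ Ur_0, v\circ Ur_1) = \varphi_j(u,v)\circ Ur_1$ for every square $r : i \to j$ of $\mathbb J$ with top $r_0$ and bottom $r_1$, and $\varphi_{j\circ i}(u,v) = \varphi_j(\varphi_i(u, v\circ Uj), v)$ for every vertically composable pair $(i,j)$; the vertical composite of $(f,\varphi)$ and $(g,\psi)$ is $g\circ f$ with the operation $\varphi_j(u,\psi_j(f\circ u,v))$; its squares are the commutative squares that are compatible with the chosen fillers. -/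

import Mathlib

open CategoryTheory

/-! ## Double categories and double functors -/

set_option linter.checkUnivs false in
/-- A (strict) double category.  The category structure on `Obj` is that of objects and horizontal
arrows; `Ver` are the vertical arrows, composed from top to bottom; `Sq t l r b` is the type of
squares with the given top, left, right and bottom boundary.  Since the boundaries of the two sides
of a unit or associativity law for squares only agree propositionally, those laws use `HEq`. -/
structure DoubleCat.{o, h, v, s} where
  Obj : Type o
  [horCat : Category.{h} Obj]
  Ver : Obj → Obj → Type v
  vid : ∀ A, Ver A A
  vcomp : ∀ {A B C}, Ver A B → Ver B C → Ver A C
  vid_vcomp : ∀ {A B} (u : Ver A B), vcomp (vid A) u = u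
  vcomp_vid : ∀ {A B} (u : Ver A B), vcomp u (vid B) = u
  vcomp_assoc : ∀ {A B C D} (u : Ver A B) (v : Ver B C) (w : Ver C D),
    vcomp (vcomp u v) w = vcomp u (vcomp v w)
  Sq : ∀ {A B C D : Obj}, (A ⟶ B) → Ver A C → Ver B D → (C ⟶ D) → Sort s
  /-- the horizontal identity square on a vertical arrow -/
  sqHid : ∀ {A C} (u : Ver A C), Sq (𝟙 A) u u (𝟙 C)
  /-- the vertical identity square on a horizontal arrow -/
  sqVid : ∀ {A B : Obj} (f : A ⟶ B), Sq f (vid A) (vid B) f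
  /-- horizontal pasting of squares -/
  sqHcomp : ∀ {A B E C D F : Obj} {t : A ⟶ B} {t' : B ⟶ E} {l : Ver A C} {m : Ver B D}
    {r : Ver E F} {b : C ⟶ D} {b' : D ⟶ F}, Sq t l m b → Sq t' m r b' → Sq (t ≫ t') l r (b ≫ b')
  /-- vertical pasting of squares -/
  sqVcomp : ∀ {A B C D E F : Obj} {t : A ⟶ B} {m : C ⟶ D} {b : E ⟶ F} {l : Ver A C}
    {r : Ver B D} {l' : Ver C E} {r' : Ver D F}, Sq t l r m → Sq m l' r' b →
    Sq t (vcomp l l') (vcomp r r') b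
  hid_hcomp : ∀ {A B C D : Obj} {t : A ⟶ B} {l : Ver A C} {r : Ver B D} {b : C ⟶ D}
    (α : Sq t l r b), HEq (sqHcomp (sqHid l) α) α
  hcomp_hid : ∀ {A B C D : Obj} {t : A ⟶ B} {l : Ver A C} {r : Ver B D} {b : C ⟶ D}
    (α : Sq t l r b), HEq (sqHcomp α (sqHid r)) α
  hcomp_assoc : ∀ {A B E G C D F H : Obj} {t : A ⟶ B} {t' : B ⟶ E} {t'' : E ⟶ G}
    {l : Ver A C} {m : Ver B D} {n : Ver E F} {r : Ver G H}
    {b : C ⟶ D} {b' : D ⟶ F} {b'' : F ⟶ H}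
    (α : Sq t l m b) (β : Sq t' m n b') (γ : Sq t'' n r b''),
    HEq (sqHcomp (sqHcomp α β) γ) (sqHcomp α (sqHcomp β γ))
  vid_sqVcomp : ∀ {A B C D : Obj} {t : A ⟶ B} {l : Ver A C} {r : Ver B D} {b : C ⟶ D}
    (α : Sq t l r b), HEq (sqVcomp (sqVid t) α) α
  sqVcomp_vid : ∀ {A B C D : Obj} {t : A ⟶ B} {l : Ver A C} {r : Ver B D} {b : C ⟶ D}
    (α : Sq t l r b), HEq (sqVcomp α (sqVid b)) α
  sqVcomp_assoc : ∀ {A B C D E F G H : Obj} {t : A ⟶ B} {m : C ⟶ D} {n : E ⟶ F} {b : G ⟶ H}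
    {l : Ver A C} {r : Ver B D} {l' : Ver C E} {r' : Ver D F} {l'' : Ver E G} {r'' : Ver F H}
    (α : Sq t l r m) (β : Sq m l' r' n) (γ : Sq n l'' r'' b),
    HEq (sqVcomp (sqVcomp α β) γ) (sqVcomp α (sqVcomp β γ))
  sqHid_vid : ∀ A, sqHid (vid A) = sqVid (𝟙 A)
  sqHid_vcomp : ∀ {A B C} (u : Ver A B) (v : Ver B C),
    sqHid (vcomp u v) = sqVcomp (sqHid u) (sqHid v)
  sqVid_comp : ∀ {A B C : Obj} (f : A ⟶ B) (g : B ⟶ C),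
    sqVid (f ≫ g) = sqHcomp (sqVid f) (sqVid g)
  interchange : ∀ {A₀ A₁ A₂ B₀ B₁ B₂ C₀ C₁ C₂ : Obj} {t : A₀ ⟶ A₁} {t' : A₁ ⟶ A₂}
    {m : B₀ ⟶ B₁} {m' : B₁ ⟶ B₂} {b : C₀ ⟶ C₁} {b' : C₁ ⟶ C₂}
    {u₀ : Ver A₀ B₀} {u₁ : Ver A₁ B₁} {u₂ : Ver A₂ B₂}
    {v₀ : Ver B₀ C₀} {v₁ : Ver B₁ C₁} {v₂ : Ver B₂ C₂}
    (α : Sq t u₀ u₁ m) (β : Sq t' u₁ u₂ m') (γ : Sq m v₀ v₁ b) (δ : Sq m' v₁ v₂ b'),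
    sqVcomp (sqHcomp α β) (sqHcomp γ δ) = sqHcomp (sqVcomp α γ) (sqVcomp β δ)

attribute [instance] DoubleCat.horCat

/-- A (strict) double functor. -/
@[ext]
structure DoubleFunctor.{o, h, v, s, o', h', v', s'}
    (D : DoubleCat.{o, h, v, s}) (D' : DoubleCat.{o', h', v', s'}) where
  obj : D.Obj → D'.Obj
  hor : ∀ {A B : D.Obj}, (A ⟶ B) → (obj A ⟶ obj B)
  ver : ∀ {A B : D.Obj}, D.Ver A B → D'.Ver (obj A) (obj B)
  sq : ∀ {A B C E : D.Obj} {t : A ⟶ B} {l : D.Ver A C} {r : D.Ver B E} {b : C ⟶ E},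
    D.Sq t l r b → D'.Sq (hor t) (ver l) (ver r) (hor b)
  hor_id : ∀ A : D.Obj, hor (𝟙 A) = 𝟙 (obj A)
  hor_comp : ∀ {A B C : D.Obj} (f : A ⟶ B) (g : B ⟶ C), hor (f ≫ g) = hor f ≫ hor g
  ver_vid : ∀ A : D.Obj, ver (D.vid A) = D'.vid (obj A)
  ver_vcomp : ∀ {A B C : D.Obj} (u : D.Ver A B) (v : D.Ver B C),
    ver (D.vcomp u v) = D'.vcomp (ver u) (ver v)
  sq_hid : ∀ {A C : D.Obj} (u : D.Ver A C), HEq (sq (D.sqHid u)) (D'.sqHid (ver u))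
  sq_vid : ∀ {A B : D.Obj} (f : A ⟶ B), HEq (sq (D.sqVid f)) (D'.sqVid (hor f))
  sq_hcomp : ∀ {A B E C F G : D.Obj} {t : A ⟶ B} {t' : B ⟶ E} {l : D.Ver A C} {m : D.Ver B F}
    {r : D.Ver E G} {b : C ⟶ F} {b' : F ⟶ G} (α : D.Sq t l m b) (β : D.Sq t' m r b'),
    HEq (sq (D.sqHcomp α β)) (D'.sqHcomp (sq α) (sq β))
  sq_vcomp : ∀ {A B C E F G : D.Obj} {t : A ⟶ B} {m : C ⟶ E} {b : F ⟶ G} {l : D.Ver A C}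
    {r : D.Ver B E} {l' : D.Ver C F} {r' : D.Ver E G} (α : D.Sq t l r m) (β : D.Sq m l' r' b),
    HEq (sq (D.sqVcomp α β)) (D'.sqVcomp (sq α) (sq β))

namespace DoubleFunctor

universe o₁ h₁ v₁ s₁ o₂ h₂ v₂ s₂ o₃ h₃ v₃ s₃

theorem heq_sq {D : DoubleCat.{o₁, h₁, v₁, s₁}} {D' : DoubleCat.{o₂, h₂, v₂, s₂}}
    (F : DoubleFunctor D D') {A B C E : D.Obj} {t t' : A ⟶ B} {l l' : D.Ver A C} {r r' : D.Ver B E}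
    {b b' : C ⟶ E} (ht : t = t') (hl : l = l') (hr : r = r') (hb : b = b')
    {α : D.Sq t l r b} {β : D.Sq t' l' r' b'} (h : HEq α β) : HEq (F.sq α) (F.sq β) := by
  subst ht hl hr hb
  rw [eq_of_heq h]

/-- The identity double functor. -/
def id (D : DoubleCat.{o₁, h₁, v₁, s₁}) : DoubleFunctor D D where
  obj A := A
  hor f := f
  ver u := u
  sq α := α
  hor_id _ := rfl
  hor_comp _ _ := rfl
  ver_vid _ := rfl
  ver_vcomp _ _ := rfl
  sq_hid _ := HEq.rfl
  sq_vid _ := HEq.rfl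
  sq_hcomp _ _ := HEq.rfl
  sq_vcomp _ _ := HEq.rfl

/-- Composition of double functors, in diagrammatic order. -/
def comp {D₁ : DoubleCat.{o₁, h₁, v₁, s₁}} {D₂ : DoubleCat.{o₂, h₂, v₂, s₂}}
    {D₃ : DoubleCat.{o₃, h₃, v₃, s₃}} (F : DoubleFunctor D₁ D₂) (G : DoubleFunctor D₂ D₃) :
    DoubleFunctor D₁ D₃ where
  obj A := G.obj (F.obj A)
  hor f := G.hor (F.hor f)
  ver u := G.ver (F.ver u)
  sq α := G.sq (F.sq α)
  hor_id A := by rw [F.hor_id, G.hor_id]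
  hor_comp f g := by rw [F.hor_comp, G.hor_comp]
  ver_vid A := by rw [F.ver_vid, G.ver_vid]
  ver_vcomp u v := by rw [F.ver_vcomp, G.ver_vcomp]
  sq_hid u := (G.heq_sq (F.hor_id _) rfl rfl (F.hor_id _) (F.sq_hid u)).trans (G.sq_hid _)
  sq_vid f := (G.heq_sq rfl (F.ver_vid _) (F.ver_vid _) rfl (F.sq_vid f)).trans (G.sq_vid _)
  sq_hcomp α β := (G.heq_sq (F.hor_comp _ _) rfl rfl (F.hor_comp _ _)
    (F.sq_hcomp α β)).trans (G.sq_hcomp _ _)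
  sq_vcomp α β := (G.heq_sq rfl (F.ver_vcomp _ _) (F.ver_vcomp _ _) rfl
    (F.sq_vcomp α β)).trans (G.sq_vcomp _ _)

/-- Two double categories `P : D₁ → S` and `Q : D₂ → S` over `S` are isomorphic over `S`. -/
def IsoOver {D₁ : DoubleCat.{o₁, h₁, v₁, s₁}} {D₂ : DoubleCat.{o₂, h₂, v₂, s₂}}
    {S : DoubleCat.{o₃, h₃, v₃, s₃}} (P : DoubleFunctor D₁ S) (Q : DoubleFunctor D₂ S) : Prop :=
  ∃ (F : DoubleFunctor D₁ D₂) (G : DoubleFunctor D₂ D₁),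
    F.comp G = id D₁ ∧ G.comp F = id D₂ ∧ F.comp Q = P

end DoubleFunctor

universe v u o h w s

/-- The double category of commutative squares in `C`. -/
def sqDouble (C : Type u) [Category.{v} C] : DoubleCat.{u, v, v, 0} where
  Obj := C
  Ver A B := A ⟶ B
  vid A := 𝟙 A
  vcomp f g := f ≫ g
  vid_vcomp := by simp
  vcomp_vid := by simp
  vcomp_assoc := by simp
  Sq t l r b := t ≫ r = l ≫ b
  sqHid u := by simp
  sqVid f := by simp
  sqHcomp {_ _ _ _ _ _ t t' l m r b b'} α β := by
    rw [Category.assoc, β, ← Category.assoc, α, Category.assoc]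
  sqVcomp {_ _ _ _ _ _ t m b l r l' r'} α β := by
    rw [← Category.assoc, α, Category.assoc, β, Category.assoc]
  hid_hcomp _ := proof_irrel_heq _ _
  hcomp_hid _ := proof_irrel_heq _ _
  hcomp_assoc _ _ _ := proof_irrel_heq _ _
  vid_sqVcomp _ := proof_irrel_heq _ _
  sqVcomp_vid _ := proof_irrel_heq _ _
  sqVcomp_assoc _ _ _ := proof_irrel_heq _ _
  sqHid_vid _ := rfl
  sqHid_vcomp _ _ := rfl
  sqVid_comp _ _ := rfl
  interchange _ _ _ _ := rfl

/-! ## The double category of morphisms with a right lifting operation -/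

section Lifting

variable {C : Type u} [Category.{v} C] {J : DoubleCat.{o, h, w, s}}
  (U : DoubleFunctor J (sqDouble C))

/-- The object of `C` underlying the image of an object under `U : J → Sq(C)`. -/
abbrev DoubleFunctor.ob (A : J.Obj) : C := U.obj A

/-- The morphism of `C` underlying the image of a horizontal arrow under `U : J → Sq(C)`. -/
abbrev DoubleFunctor.hmor {A B : J.Obj} (f : A ⟶ B) : U.ob A ⟶ U.ob B := U.hor f

/-- The morphism of `C` underlying the image of a vertical arrow under `U : J → Sq(C)`. -/
abbrev DoubleFunctor.vmor {A B : J.Obj} (j : J.Ver A B) : U.ob A ⟶ U.ob B := U.ver j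

/-- Morphisms `X ⟶ Y` of `C` with a lifting operation against `U : J → Sq(C)`, subject to the
horizontal and vertical compatibility conditions. -/
@[ext]
structure LiftMor (X Y : C) where
  f : X ⟶ Y
  lift : ∀ {A B : J.Obj} (j : J.Ver A B) (x : U.ob A ⟶ X) (y : U.ob B ⟶ Y),
    x ≫ f = U.vmor j ≫ y → (U.ob B ⟶ X)
  left_fac : ∀ {A B : J.Obj} (j : J.Ver A B) (x : U.ob A ⟶ X) (y : U.ob B ⟶ Y)
    (e : x ≫ f = U.vmor j ≫ y), U.vmor j ≫ lift j x y e = x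
  right_fac : ∀ {A B : J.Obj} (j : J.Ver A B) (x : U.ob A ⟶ X) (y : U.ob B ⟶ Y)
    (e : x ≫ f = U.vmor j ≫ y), lift j x y e ≫ f = y
  horizontal : ∀ {A B A' B' : J.Obj} {t : A ⟶ A'} {i : J.Ver A B} {j : J.Ver A' B'} {b : B ⟶ B'}
    (_ : J.Sq t i j b) (x : U.ob A' ⟶ X) (y : U.ob B' ⟶ Y) (e : x ≫ f = U.vmor j ≫ y)
    (e' : (U.hmor t ≫ x) ≫ f = U.vmor i ≫ U.hmor b ≫ y),
    lift i (U.hmor t ≫ x) (U.hmor b ≫ y) e' = U.hmor b ≫ lift j x y e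
  vertical : ∀ {A B D : J.Obj} (i : J.Ver A B) (j : J.Ver B D) (x : U.ob A ⟶ X) (y : U.ob D ⟶ Y)
    (e : x ≫ f = U.vmor (J.vcomp i j) ≫ y) (e₁ : x ≫ f = U.vmor i ≫ U.vmor j ≫ y)
    (e₂ : lift i x (U.vmor j ≫ y) e₁ ≫ f = U.vmor j ≫ y),
    lift j (lift i x (U.vmor j ≫ y) e₁) y e₂ = lift (J.vcomp i j) x y e

namespace LiftMor

variable {U}

theorem lift_congr {X Y : C} (p : LiftMor U X Y) {A B : J.Obj} (j : J.Ver A B)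
    {x x' : U.ob A ⟶ X} {y y' : U.ob B ⟶ Y} (hx : x = x') (hy : y = y')
    (e : x ≫ p.f = U.vmor j ≫ y) (e' : x' ≫ p.f = U.vmor j ≫ y') :
    p.lift j x y e = p.lift j x' y' e' := by
  subst hx hy
  rfl

theorem ext' {X Y : C} {p q : LiftMor U X Y} (hf : p.f = q.f)
    (hl : ∀ {A B : J.Obj} (j : J.Ver A B) (x : U.ob A ⟶ X) (y : U.ob B ⟶ Y)
      (e : x ≫ p.f = U.vmor j ≫ y) (e' : x ≫ q.f = U.vmor j ≫ y),
      p.lift j x y e = q.lift j x y e') : p = q := by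
  obtain ⟨f, l, _, _, _, _⟩ := p
  obtain ⟨f', l', _, _, _, _⟩ := q
  dsimp only at hf
  subst hf
  have : @l = @l' := by
    funext A B j x y e
    exact hl j x y e e
  subst this
  rfl

theorem vmor_vcomp {A B D : J.Obj} (i : J.Ver A B) (j : J.Ver B D) :
    U.vmor (J.vcomp i j) = U.vmor i ≫ U.vmor j := U.ver_vcomp i j

theorem hmor_vmor {A B A' B' : J.Obj} {t : A ⟶ A'} {i : J.Ver A B} {j : J.Ver A' B'} {b : B ⟶ B'}
    (α : J.Sq t i j b) : U.hmor t ≫ U.vmor j = U.vmor i ≫ U.hmor b := U.sq α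

variable (U) in
/-- The identity of `X`, with its only lifting operation. -/
def vid (X : C) : LiftMor U X X where
  f := 𝟙 X
  lift _ _ y _ := y
  left_fac j x y e := by rw [← e, Category.comp_id]
  right_fac _ _ _ _ := Category.comp_id _
  horizontal _ _ _ _ _ := rfl
  vertical _ _ _ _ _ _ _ := rfl

/-- Vertical composition: to lift against `g ∘ f`, lift first against `g` and then against `f`. -/
def vcomp {X Y Z : C} (p : LiftMor U X Y) (q : LiftMor U Y Z) : LiftMor U X Z where
  f := p.f ≫ q.f
  lift j x y e := p.lift j x (q.lift j (x ≫ p.f) y ((Category.assoc _ _ _).trans e))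
    (q.left_fac j _ _ _).symm
  left_fac j x y e := p.left_fac _ _ _ _
  right_fac j x y e := by rw [← Category.assoc, p.right_fac, q.right_fac]
  horizontal {A B A' B' t i j b} α x y e e' := by
    rw [← p.horizontal α]
    · refine p.lift_congr _ rfl ?_ _ _
      rw [← q.horizontal α]
      · exact q.lift_congr _ (Category.assoc _ _ _) rfl _ _
      · rw [Category.assoc, Category.assoc, ← e', Category.assoc]
    · rw [← q.horizontal α]
      · rw [q.left_fac, Category.assoc]
      · rw [Category.assoc, Category.assoc, ← e', Category.assoc]
  vertical {A B D} i j x y e e₁ e₂ := by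
    have e₁' : (x ≫ p.f) ≫ q.f = U.vmor i ≫ U.vmor j ≫ y := by rw [Category.assoc, e₁]
    have e' : (x ≫ p.f) ≫ q.f = U.vmor (J.vcomp i j) ≫ y := by rw [Category.assoc, e]
    have hq := q.vertical i j (x ≫ p.f) y e' e₁' (q.right_fac _ _ _ _)
    have hj : U.vmor j ≫ q.lift (J.vcomp i j) (x ≫ p.f) y e'
        = q.lift i (x ≫ p.f) (U.vmor j ≫ y) e₁' := by
      rw [← hq, q.left_fac]
    have hi : x ≫ p.f = U.vmor (J.vcomp i j) ≫ q.lift (J.vcomp i j) (x ≫ p.f) y e' :=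
      (q.left_fac _ _ _ _).symm
    have hi' : x ≫ p.f = U.vmor i ≫ U.vmor j ≫ q.lift (J.vcomp i j) (x ≫ p.f) y e' := by
      rw [hj, q.left_fac]
    rw [← p.vertical i j x _ hi hi' (p.right_fac _ _ _ _)]
    refine p.lift_congr _ (p.lift_congr _ rfl hj.symm _ _) ?_ _ _
    rw [← hq]
    exact q.lift_congr _ (p.right_fac _ _ _ _) rfl _ _

/-- Squares between morphisms with lifting operations: commutative squares `(a, b)` that are
compatible with the lifting operations. -/
structure IsSquare {X Y X' Y' : C} (a : X ⟶ X') (p : LiftMor U X Y) (q : LiftMor U X' Y')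
    (b : Y ⟶ Y') : Prop where
  comm : a ≫ q.f = p.f ≫ b
  lift_comp : ∀ {A B : J.Obj} (j : J.Ver A B) (x : U.ob A ⟶ X) (y : U.ob B ⟶ Y)
    (e : x ≫ p.f = U.vmor j ≫ y) (e' : (x ≫ a) ≫ q.f = U.vmor j ≫ y ≫ b),
    p.lift j x y e ≫ a = q.lift j (x ≫ a) (y ≫ b) e'

namespace IsSquare

theorem hid {X Y : C} (p : LiftMor U X Y) : IsSquare (𝟙 X) p p (𝟙 Y) where
  comm := by rw [Category.id_comp, Category.comp_id]
  lift_comp j x y e e' := by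
    rw [Category.comp_id]
    exact p.lift_congr _ (Category.comp_id _).symm (Category.comp_id _).symm _ _

theorem vid {X X' : C} (f : X ⟶ X') : IsSquare f (LiftMor.vid U X) (LiftMor.vid U X') f where
  comm := (Category.comp_id f).trans (Category.id_comp f).symm
  lift_comp _ _ _ _ _ := rfl

theorem hcomp {X Y X' Y' X'' Y'' : C} {a : X ⟶ X'} {a' : X' ⟶ X''} {b : Y ⟶ Y'} {b' : Y' ⟶ Y''}
    {p : LiftMor U X Y} {q : LiftMor U X' Y'} {r : LiftMor U X'' Y''}
    (α : IsSquare a p q b) (β : IsSquare a' q r b') : IsSquare (a ≫ a') p r (b ≫ b') where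
  comm := by rw [Category.assoc, β.comm, ← Category.assoc, α.comm, Category.assoc]
  lift_comp j x y e e' := by
    have h : (x ≫ a) ≫ q.f = U.vmor j ≫ y ≫ b := by
      rw [Category.assoc, α.comm, ← Category.assoc, e, Category.assoc]
    rw [← Category.assoc, α.lift_comp j x y e h, β.lift_comp j]
    · exact r.lift_congr _ (Category.assoc _ _ _) (Category.assoc _ _ _) _ _
    · simp only [Category.assoc] at e' ⊢
      exact e'

theorem vcomp {X Y Z X' Y' Z' : C} {a : X ⟶ X'} {b : Y ⟶ Y'} {c : Z ⟶ Z'}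
    {p : LiftMor U X Y} {p' : LiftMor U X' Y'} {q : LiftMor U Y Z} {q' : LiftMor U Y' Z'}
    (α : IsSquare a p p' b) (β : IsSquare b q q' c) :
    IsSquare a (p.vcomp q) (p'.vcomp q') c where
  comm := by
    change a ≫ p'.f ≫ q'.f = (p.f ≫ q.f) ≫ c
    rw [← Category.assoc, α.comm, Category.assoc, β.comm, Category.assoc]
  lift_comp j x y e e' := by
    have e₁ : x ≫ p.f ≫ q.f = U.vmor j ≫ y := e
    have e₂ : (x ≫ a) ≫ p'.f ≫ q'.f = U.vmor j ≫ y ≫ c := e'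
    have e₃ : ((x ≫ p.f) ≫ b) ≫ q'.f = U.vmor j ≫ y ≫ c := by
      rw [Category.assoc x, ← α.comm, ← e₂]
      simp only [Category.assoc]
    have e₄ : (x ≫ p.f) ≫ q.f = U.vmor j ≫ y := by rw [Category.assoc, e₁]
    have h := β.lift_comp j (x ≫ p.f) y e₄ e₃
    have e₅ : (x ≫ a) ≫ p'.f = U.vmor j ≫ q.lift j (x ≫ p.f) y e₄ ≫ b := by
      rw [← Category.assoc, q.left_fac, Category.assoc, Category.assoc, α.comm]
    refine (α.lift_comp j _ _ _ e₅).trans (p'.lift_congr _ rfl (h.trans ?_) _ _)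
    exact q'.lift_congr _ (by rw [Category.assoc, Category.assoc, α.comm]) rfl _ _

end IsSquare

end LiftMor

/-- The double category of morphisms with a right lifting operation against `U : J → Sq(C)`. -/
def liftDouble : DoubleCat.{u, v, max v o w, 0} where
  Obj := C
  Ver X Y := LiftMor U X Y
  vid X := LiftMor.vid U X
  vcomp p q := p.vcomp q
  vid_vcomp p := LiftMor.ext' (Category.id_comp _) fun _ _ _ _ _ =>
    p.lift_congr _ (Category.comp_id _) rfl _ _
  vcomp_vid _ := LiftMor.ext' (Category.comp_id _) fun _ _ _ _ _ => rfl
  vcomp_assoc p q r := LiftMor.ext' (Category.assoc _ _ _) fun _ _ _ _ _ =>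
    p.lift_congr _ rfl (q.lift_congr _ rfl (r.lift_congr _ (Category.assoc _ _ _).symm rfl _ _) _ _)
      _ _
  Sq t l r b := LiftMor.IsSquare t l r b
  sqHid p := LiftMor.IsSquare.hid p
  sqVid f := LiftMor.IsSquare.vid f
  sqHcomp α β := α.hcomp β
  sqVcomp α β := α.vcomp β
  hid_hcomp _ := proof_irrel_heq _ _
  hcomp_hid _ := proof_irrel_heq _ _
  hcomp_assoc _ _ _ := proof_irrel_heq _ _
  vid_sqVcomp _ := proof_irrel_heq _ _
  sqVcomp_vid _ := proof_irrel_heq _ _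
  sqVcomp_assoc _ _ _ := proof_irrel_heq _ _
  sqHid_vid _ := rfl
  sqHid_vcomp _ _ := rfl
  sqVid_comp _ _ := rfl
  interchange _ _ _ _ := rfl

/-- The forgetful double functor. -/
def liftForget : DoubleFunctor (liftDouble U) (sqDouble C) where
  obj X := X
  hor f := f
  ver p := p.f
  sq α := α.comm
  hor_id _ := rfl
  hor_comp _ _ := rfl
  ver_vid _ := rfl
  ver_vcomp _ _ := rfl
  sq_hid _ := proof_irrel_heq _ _
  sq_vid _ := proof_irrel_heq _ _
  sq_hcomp _ _ := proof_irrel_heq _ _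
  sq_vcomp _ _ := proof_irrel_heq _ _

end Lifting

/-! ## Algebraic weak factorisation systems -/

section AWFS

variable {C : Type u} [Category.{v} C]

/-- Functorial factorisations `f = p f ∘ i f` on `C`, with no condition on the two factors. -/
abbrev FunctFact (C : Type u) [Category.{v} C] :=
  MorphismProperty.FunctorialFactorizationData (⊤ : MorphismProperty C) (⊤ : MorphismProperty C)

namespace FunctFact

variable (W : FunctFact C)

/-- The functor `L` sending `f` to the first factor of its factorisation. -/
def L : Arrow C ⥤ Arrow C where
  obj f := Arrow.mk (W.i.app f)
  map {f g} a := Arrow.homMk' a.left (W.Z.map a) (W.i.naturality a)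
  map_id f := by
    ext
    · rfl
    · exact W.Z.map_id f
  map_comp a b := by
    ext
    · rfl
    · exact W.Z.map_comp a b

/-- The functor `R` sending `f` to the second factor of its factorisation. -/
def R : Arrow C ⥤ Arrow C where
  obj f := Arrow.mk (W.p.app f)
  map {f g} a := Arrow.homMk' (W.Z.map a) a.right (W.p.naturality a)
  map_id f := by
    ext
    · exact W.Z.map_id f
    · rfl
  map_comp a b := by
    ext
    · exact W.Z.map_comp a b
    · rfl

/-- The copointing `(1, Rf) : Lf ⟶ f`. -/
def counit : W.L ⟶ 𝟭 (Arrow C) where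
  app f := Arrow.homMk (f := W.L.obj f) (g := f) (𝟙 f.left) (W.p.app f)
    ((Category.id_comp _).trans W.fac_app.symm)
  naturality f g a := by
    ext
    · exact (Category.comp_id _).trans (Category.id_comp _).symm
    · exact W.p.naturality a

/-- The pointing `(Lf, 1) : f ⟶ Rf`. -/
def unit : 𝟭 (Arrow C) ⟶ W.R where
  app f := Arrow.homMk (f := f) (g := W.R.obj f) (W.i.app f) (𝟙 f.right)
    (W.fac_app.trans (Category.comp_id _).symm)
  naturality f g a := by
    ext
    · exact W.i.naturality a
    · exact (Category.comp_id _).trans (Category.id_comp _).symm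

end FunctFact

/-- The data of an algebraic weak factorisation system, without the distributive law: a functorial
factorisation such that the copointed endofunctor `L` underlies a comonad and the pointed
endofunctor `R` underlies a monad on the category of arrows.  By the counit and unit laws, the domain
component of `comul` and the codomain component of `mul` are identities. -/
structure PreAWFS (C : Type u) [Category.{v} C] where
  fact : FunctFact C
  comul : fact.L ⟶ fact.L ⋙ fact.L
  left_counit : ∀ f, comul.app f ≫ fact.counit.app (fact.L.obj f) = 𝟙 (fact.L.obj f)
  right_counit : ∀ f, comul.app f ≫ fact.L.map (fact.counit.app f) = 𝟙 (fact.L.obj f)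
  coassoc : ∀ f, comul.app f ≫ fact.L.map (comul.app f) =
    comul.app f ≫ comul.app (fact.L.obj f)
  mul : fact.R ⋙ fact.R ⟶ fact.R
  left_unit : ∀ f, fact.unit.app (fact.R.obj f) ≫ mul.app f = 𝟙 (fact.R.obj f)
  right_unit : ∀ f, fact.R.map (fact.unit.app f) ≫ mul.app f = 𝟙 (fact.R.obj f)
  assoc : ∀ f, fact.R.map (mul.app f) ≫ mul.app f = mul.app (fact.R.obj f) ≫ mul.app f

namespace PreAWFS

variable (W : PreAWFS C)

/-- The comonad `L` on the category of arrows. -/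
def comonad : Comonad (Arrow C) where
  toFunctor := W.fact.L
  ε := W.fact.counit
  δ := W.comul
  coassoc := W.coassoc
  left_counit := W.left_counit
  right_counit := W.right_counit

/-- The monad `R` on the category of arrows. -/
def monad : Monad (Arrow C) where
  toFunctor := W.fact.R
  η := W.fact.unit
  μ := W.mul
  assoc := W.assoc
  left_unit := W.left_unit
  right_unit := W.right_unit

section Elementary

/-- The middle object `E f` of the factorisation of `f`. -/
def E {X Y : C} (f : X ⟶ Y) : C := W.fact.Z.obj (Arrow.mk f)

/-- The first factor of `f`. -/
def l {X Y : C} (f : X ⟶ Y) : X ⟶ W.E f := W.fact.i.app (Arrow.mk f)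

/-- The second factor of `f`. -/
def r {X Y : C} (f : X ⟶ Y) : W.E f ⟶ Y := W.fact.p.app (Arrow.mk f)

/-- The action of `E` on the commutative square `(b, c) : f ⟶ g`. -/
def map {X Y X' Y' : C} (f : X ⟶ Y) (g : X' ⟶ Y') (b : X ⟶ X') (c : Y ⟶ Y')
    (w : b ≫ g = f ≫ c) : W.E f ⟶ W.E g :=
  W.fact.Z.map (Arrow.homMk' b c w)

/-- The codomain component `E f ⟶ E (L f)` of the comultiplication. -/
def δ {X Y : C} (f : X ⟶ Y) : W.E f ⟶ W.E (W.l f) := (W.comul.app (Arrow.mk f)).right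

/-- The domain component `E (R f) ⟶ E f` of the multiplication. -/
def μ {X Y : C} (f : X ⟶ Y) : W.E (W.r f) ⟶ W.E f := (W.mul.app (Arrow.mk f)).left

theorem δ_r {X Y : C} (f : X ⟶ Y) : W.δ f ≫ W.r (W.l f) = 𝟙 (W.E f) :=
  congrArg CommaMorphism.right (W.left_counit (Arrow.mk f))

theorem l_μ {X Y : C} (f : X ⟶ Y) : W.l (W.r f) ≫ W.μ f = 𝟙 (W.E f) :=
  congrArg CommaMorphism.left (W.left_unit (Arrow.mk f))

variable {W} in
theorem map_congr {X Y X' Y' : C} {f : X ⟶ Y} {g : X' ⟶ Y'} {b b' : X ⟶ X'} {c c' : Y ⟶ Y'}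
    (hb : b = b') (hc : c = c') (w : b ≫ g = f ≫ c) :
    W.map f g b c w = W.map f g b' c' (hb ▸ hc ▸ w) := by
  subst hb hc
  rfl

theorem map_id {X Y : C} (f : X ⟶ Y) (w : 𝟙 X ≫ f = f ≫ 𝟙 Y) :
    W.map f f (𝟙 X) (𝟙 Y) w = 𝟙 _ := W.fact.Z.map_id (Arrow.mk f)

theorem map_map {X Y X' Y' X'' Y'' : C} (f : X ⟶ Y) (g : X' ⟶ Y') (h : X'' ⟶ Y'')
    (b : X ⟶ X') (c : Y ⟶ Y') (b' : X' ⟶ X'') (c' : Y' ⟶ Y'')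
    (w : b ≫ g = f ≫ c) (w' : b' ≫ h = g ≫ c') :
    W.map f g b c w ≫ W.map g h b' c' w' = W.map f h (b ≫ b') (c ≫ c')
      (by rw [Category.assoc, w', ← Category.assoc, w, Category.assoc]) :=
  (W.fact.Z.map_comp _ _).symm

theorem l_map {X Y X' Y' : C} (f : X ⟶ Y) (g : X' ⟶ Y') (b : X ⟶ X') (c : Y ⟶ Y')
    (w : b ≫ g = f ≫ c) : W.l f ≫ W.map f g b c w = b ≫ W.l g :=
  (W.fact.i.naturality (Arrow.homMk' b c w)).symm

theorem map_r {X Y X' Y' : C} (f : X ⟶ Y) (g : X' ⟶ Y') (b : X ⟶ X') (c : Y ⟶ Y')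
    (w : b ≫ g = f ≫ c) : W.map f g b c w ≫ W.r g = W.r f ≫ c :=
  W.fact.p.naturality (Arrow.homMk' b c w)

theorem l_r {X Y : C} (f : X ⟶ Y) : W.l f ≫ W.r f = f := W.fact.fac_app

theorem map_δ {X Y X' Y' : C} (f : X ⟶ Y) (g : X' ⟶ Y') (b : X ⟶ X') (c : Y ⟶ Y')
    (w : b ≫ g = f ≫ c) : W.map f g b c w ≫ W.δ g = W.δ f ≫
      W.map (W.l f) (W.l g) b (W.map f g b c w) (W.l_map f g b c w).symm :=
  congrArg CommaMorphism.right (W.comul.naturality (Arrow.homMk' b c w))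

theorem map_μ {X Y X' Y' : C} (f : X ⟶ Y) (g : X' ⟶ Y') (b : X ⟶ X') (c : Y ⟶ Y')
    (w : b ≫ g = f ≫ c) : W.map (W.r f) (W.r g) (W.map f g b c w) c
      (W.map_r f g b c w) ≫ W.μ g = W.μ f ≫ W.map f g b c w :=
  congrArg CommaMorphism.left (W.mul.naturality (Arrow.homMk' b c w))

theorem comul_left (f : Arrow C) : (W.comul.app f).left = 𝟙 f.left :=
  (Category.comp_id _).symm.trans (congrArg CommaMorphism.left (W.left_counit f))

theorem mul_right (f : Arrow C) : (W.mul.app f).right = 𝟙 f.right :=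
  (Category.id_comp _).symm.trans (congrArg CommaMorphism.right (W.left_unit f))

theorem l_δ {X Y : C} (f : X ⟶ Y) : W.l f ≫ W.δ f =
    W.l (W.l f) := by
  have h : _ = W.l f ≫ W.δ f := (W.comul.app (Arrow.mk f)).w
  refine h.symm.trans ?_
  change (W.comul.app (Arrow.mk f)).left ≫ _ = _
  rw [comul_left]
  exact Category.id_comp _

theorem δ_map_r {X Y : C} (f : X ⟶ Y) : W.δ f ≫ W.map (W.l f) f (𝟙 X)
    (W.r f) ((Category.id_comp _).trans (W.l_r f).symm) = 𝟙 _ :=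
  congrArg CommaMorphism.right (W.right_counit (Arrow.mk f))

theorem δ_map_δ {X Y : C} (f : X ⟶ Y) : W.δ f ≫ W.map (W.l f)
    (W.l (W.l f)) (𝟙 X) (W.δ f)
      ((Category.id_comp _).trans (W.l_δ f).symm) =
    W.δ f ≫ W.δ (W.l f) := by
  have h := congrArg CommaMorphism.right (W.coassoc (Arrow.mk f))
  refine Eq.trans ?_ h
  change _ = W.δ f ≫ W.fact.Z.map (W.comul.app (Arrow.mk f))
  congr 1
  apply congrArg W.fact.Z.map
  ext
  · exact (W.comul_left (Arrow.mk f)).symm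
  · rfl

end Elementary

end PreAWFS

/-- An algebraic weak factorisation system.  The axiom says that the natural transformation
`L R ⟶ R L` with components `(δ f, μ f) : L (R f) ⟶ R (L f)` is a distributive law of the comonad
`L` over the monad `R`: its compatibility with the unit and the counit is automatic, and its
compatibility with the multiplication and with the comultiplication both amount to this equation. -/
structure AWFS (C : Type u) [Category.{v} C] extends PreAWFS C where
  distrib : ∀ {X Y : C} (f : X ⟶ Y), toPreAWFS.μ f ≫ toPreAWFS.δ f =
    toPreAWFS.δ (toPreAWFS.r f) ≫
      toPreAWFS.map (toPreAWFS.l (toPreAWFS.r f)) (toPreAWFS.r (toPreAWFS.l f))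
        (toPreAWFS.δ f) (toPreAWFS.μ f) ((toPreAWFS.δ_r f).trans (toPreAWFS.l_μ f).symm) ≫
      toPreAWFS.μ (toPreAWFS.l f)

namespace PreAWFS

/-- An arrow `X ⟶ Y` with the structure of an algebra for the monad `R`. -/
@[ext]
structure RAlg (W : PreAWFS C) (X Y : C) where
  f : X ⟶ Y
  a : W.monad.obj (Arrow.mk f) ⟶ Arrow.mk f
  unit : W.monad.η.app (Arrow.mk f) ≫ a = 𝟙 (Arrow.mk f)
  assoc : W.monad.μ.app (Arrow.mk f) ≫ a = W.monad.map a ≫ a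

variable {W : PreAWFS C}

/-- The corresponding object of the category of algebras of the monad `R`. -/
def RAlg.toAlgebra {X Y : C} (p : W.RAlg X Y) : W.monad.Algebra where
  A := Arrow.mk p.f
  a := p.a
  unit := p.unit
  assoc := p.assoc

/-- Squares of algebras: commutative squares that are morphisms of algebras. -/
structure RAlg.IsSquare {X Y X' Y' : C} (b : X ⟶ X') (p : W.RAlg X Y) (q : W.RAlg X' Y')
    (c : Y ⟶ Y') : Prop where
  comm : b ≫ q.f = p.f ≫ c
  map_comp : W.monad.map (Arrow.homMk' b c comm) ≫ q.a = p.a ≫ Arrow.homMk' b c comm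

namespace RAlg

/-- The domain component `E f ⟶ X` of the algebra structure. -/
def s {X Y : C} (p : W.RAlg X Y) : W.E p.f ⟶ X := p.a.left

theorem a_right {X Y : C} (p : W.RAlg X Y) : p.a.right = 𝟙 Y :=
  (Category.id_comp _).symm.trans (congrArg CommaMorphism.right p.unit)

theorem l_s {X Y : C} (p : W.RAlg X Y) : W.l p.f ≫ p.s = 𝟙 X :=
  congrArg CommaMorphism.left p.unit

theorem s_f {X Y : C} (p : W.RAlg X Y) : p.s ≫ p.f = W.r p.f := by
  have h : p.s ≫ p.f = W.r p.f ≫ p.a.right := p.a.w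
  rw [h, a_right]
  exact Category.comp_id _

theorem μ_s {X Y : C} (p : W.RAlg X Y) (w) : W.μ p.f ≫ p.s =
    W.map (W.r p.f) p.f p.s (𝟙 Y) w ≫ p.s := by
  have h : W.μ p.f ≫ p.s = W.fact.Z.map p.a ≫ p.s := congrArg CommaMorphism.left p.assoc
  rw [h]
  congr 1
  apply congrArg W.fact.Z.map
  ext
  · rfl
  · exact p.a_right

/-- An algebra structure from its domain component. -/
def ofS {X Y : C} (f : X ⟶ Y) (s : W.E f ⟶ X) (l_s : W.l f ≫ s = 𝟙 X)
    (s_f : s ≫ f = W.r f)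
    (μ_s : W.μ f ≫ s = W.map (W.r f) f s (𝟙 Y)
      (s_f.trans (Category.comp_id _).symm) ≫ s) : W.RAlg X Y where
  f := f
  a := Arrow.homMk' (f := W.r f) (g := f) s (𝟙 Y) (s_f.trans (Category.comp_id _).symm)
  unit := by
    ext
    · exact l_s
    · exact Category.comp_id _
  assoc := by
    ext
    · exact μ_s
    · refine congrArg (fun t => t ≫ 𝟙 Y) ?_
      exact W.mul_right (Arrow.mk f)

theorem ext' {X Y : C} {p q : W.RAlg X Y} (hf : p.f = q.f)
    (hs : p.s = W.map p.f q.f (𝟙 X) (𝟙 Y) (by rw [hf, Category.comp_id, Category.id_comp]) ≫ q.s) :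
    p = q := by
  have hp := p.a_right
  have hq := q.a_right
  obtain ⟨f, a, _, _⟩ := p
  obtain ⟨f', a', _, _⟩ := q
  dsimp only at hf
  subst hf
  rw [map_id, Category.id_comp] at hs
  have : a = a' := by
    ext
    · exact hs
    · exact hp.trans hq.symm
  subst this
  rfl

theorem isSquare_iff {X Y X' Y' : C} {b : X ⟶ X'} {p : W.RAlg X Y} {q : W.RAlg X' Y'}
    {c : Y ⟶ Y'} : IsSquare b p q c ↔
      ∃ w : b ≫ q.f = p.f ≫ c, W.map p.f q.f b c w ≫ q.s = p.s ≫ b := by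
  constructor
  · rintro ⟨w, h⟩
    exact ⟨w, congrArg CommaMorphism.left h⟩
  · rintro ⟨w, h⟩
    refine ⟨w, ?_⟩
    ext
    · exact h
    · change c ≫ q.a.right = p.a.right ≫ c
      rw [q.a_right, p.a_right]
      exact (Category.comp_id c).trans (Category.id_comp c).symm

variable (W) in
/-- The identity of `X` with its only algebra structure. -/
def vid (X : C) : W.RAlg X X :=
  ofS (𝟙 X) (W.r (𝟙 X)) (W.l_r _) (Category.comp_id _) (by
    rw [map_r, Category.comp_id]
    have h := (W.mul.app (Arrow.mk (𝟙 X))).w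
    have h' : W.μ (𝟙 X) ≫ W.r (𝟙 X) =
      W.r (W.r (𝟙 X)) ≫ (W.mul.app (Arrow.mk (𝟙 X))).right := h
    rw [h', mul_right]
    exact Category.comp_id _)

end RAlg

end PreAWFS

namespace AWFS

variable {W : AWFS C}

open PreAWFS

section

variable {X Y Z : C} (p : W.RAlg X Y) (q : W.RAlg Y Z)

/-- The lift of the square `(f, R (gf)) : L (gf) ⟶ g` obtained from the algebra structure of `g`. -/
def compW : W.E (p.f ≫ q.f) ⟶ Y :=
  W.map (p.f ≫ q.f) q.f p.f (𝟙 Z) (Category.comp_id _).symm ≫ q.s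

theorem compW_def : compW p q =
    W.map (p.f ≫ q.f) q.f p.f (𝟙 Z) (Category.comp_id _).symm ≫ q.s := rfl

theorem l_compW : W.l (p.f ≫ q.f) ≫ compW p q = p.f := by
  rw [compW, ← Category.assoc, l_map, Category.assoc, q.l_s, Category.comp_id]

theorem compW_f : compW p q ≫ q.f = W.r (p.f ≫ q.f) := by
  rw [compW, Category.assoc, q.s_f, map_r, Category.comp_id]

/-- The algebra structure map of the vertical composite of two algebras. -/
def compS : W.E (p.f ≫ q.f) ⟶ X :=
  W.δ (p.f ≫ q.f) ≫ W.map (W.l (p.f ≫ q.f)) p.f (𝟙 X) (compW p q)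
    ((Category.id_comp _).trans (l_compW p q).symm) ≫ p.s

theorem compS_def : compS p q = W.δ (p.f ≫ q.f) ≫
    W.map (W.l (p.f ≫ q.f)) p.f (𝟙 X) (compW p q)
      ((Category.id_comp _).trans (l_compW p q).symm) ≫ p.s := rfl

theorem compS_f : compS p q ≫ p.f = compW p q := by
  rw [compS, Category.assoc, Category.assoc, p.s_f, map_r, ← Category.assoc]
  rw [δ_r, Category.id_comp]

theorem l_compS : W.l (p.f ≫ q.f) ≫ compS p q = 𝟙 X := by
  rw [compS, ← Category.assoc, l_δ, ← Category.assoc, l_map, Category.id_comp, p.l_s]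

theorem μ_compW (w) : W.μ (p.f ≫ q.f) ≫ compW p q =
    W.map (W.r (p.f ≫ q.f)) q.f (compW p q) (𝟙 Z) w ≫ q.s := by
  refine (congrArg (CategoryStruct.comp _) (compW_def p q)).trans ?_
  rw [← Category.assoc, ← map_μ, Category.assoc,
    q.μ_s (q.s_f.trans (Category.comp_id _).symm), ← Category.assoc, map_map]
  congr 1
  exact map_congr rfl (Category.comp_id _) _

theorem μ_compS (w) : W.μ (p.f ≫ q.f) ≫ compS p q =
    W.map (W.r (p.f ≫ q.f)) (p.f ≫ q.f) (compS p q) (𝟙 Z) w ≫ compS p q := by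
  have e₁ : compW p q = compS p q ≫ p.f := (compS_f p q).symm
  have w₁ : compW p q ≫ q.f = W.r (p.f ≫ q.f) ≫ 𝟙 Z := by
    rw [compW_f, Category.comp_id]
  have key : W.map (W.r (p.f ≫ q.f)) (p.f ≫ q.f) (compS p q) (𝟙 Z) w ≫ compW p q =
      W.μ (p.f ≫ q.f) ≫ compW p q := by
    rw [μ_compW p q w₁]
    refine (congrArg (CategoryStruct.comp _) (compW_def p q)).trans ?_
    rw [← Category.assoc, map_map]
    congr 1
    exact map_congr (compS_f p q) (Category.comp_id _) _
  have hl : W.μ (p.f ≫ q.f) ≫ compS p q = W.δ (W.r (p.f ≫ q.f)) ≫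
      W.map (W.l (W.r (p.f ≫ q.f))) p.f (compS p q)
        (W.μ (p.f ≫ q.f) ≫ compW p q) (by
          rw [← Category.assoc, compS_f, l_μ, Category.id_comp]) ≫
        p.s := by
    refine (congrArg (CategoryStruct.comp _) (compS_def p q)).trans ?_
    rw [← Category.assoc, W.distrib, Category.assoc,
      Category.assoc]
    congr 1
    rw [← Category.assoc (W.μ _), ← map_μ, Category.assoc,
      p.μ_s (p.s_f.trans (Category.comp_id _).symm), ← Category.assoc, ← Category.assoc, map_map,
      map_map]
    congr 1
    refine map_congr ?_ (Category.comp_id _) _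
    rw [compS, Category.assoc]
  have hr : W.map (W.r (p.f ≫ q.f)) (p.f ≫ q.f) (compS p q) (𝟙 Z) w ≫ compS p q =
      W.δ (W.r (p.f ≫ q.f)) ≫
      W.map (W.l (W.r (p.f ≫ q.f))) p.f (compS p q)
        (W.map (W.r (p.f ≫ q.f)) (p.f ≫ q.f) (compS p q) (𝟙 Z) w ≫ compW p q) (by
          rw [← Category.assoc, l_map, Category.assoc, l_compW]) ≫ p.s := by
    refine (congrArg (CategoryStruct.comp _) (compS_def p q)).trans ?_
    rw [← Category.assoc, map_δ, Category.assoc, ← Category.assoc (W.map _ _ _ _ _), map_map]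
    congr 2
    exact map_congr (Category.comp_id _) rfl _
  rw [hl, hr]
  congr 2
  exact map_congr rfl key.symm _

end

/-- The vertical composite of the algebras `(f, s)` and `(g, t)`, with structure map
`E (gf) → E (L (gf)) → E f → X`, namely `δ` followed by `E (1, t ∘ E (f, 1))` and `s`. -/
def vcomp {X Y Z : C} (p : W.RAlg X Y) (q : W.RAlg Y Z) : W.RAlg X Z :=
  RAlg.ofS (p.f ≫ q.f) (compS p q) (l_compS p q)
    (by rw [← Category.assoc, compS_f, compW_f]) (μ_compS p q _)

theorem vcomp_f {X Y Z : C} (p : W.RAlg X Y) (q : W.RAlg Y Z) : (vcomp p q).f = p.f ≫ q.f := rfl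

theorem vcomp_s {X Y Z : C} (p : W.RAlg X Y) (q : W.RAlg Y Z) : (vcomp p q).s = compS p q := rfl

/-- Naturality of `compS` in squares out of arbitrary morphisms. -/
theorem map_compS {X Y Z X' Z' : C} (p : W.RAlg X Y) (q : W.RAlg Y Z) (h : X' ⟶ Z')
    (b : X' ⟶ X) (c : Z' ⟶ Z) (w : b ≫ p.f ≫ q.f = h ≫ c) :
    W.map h (p.f ≫ q.f) b c w ≫ compS p q = W.δ h ≫ W.map (W.l h) p.f b
      (W.map h q.f (b ≫ p.f) c (by rw [Category.assoc, w]) ≫ q.s) (by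
        rw [← Category.assoc, l_map, Category.assoc, q.l_s, Category.comp_id]) ≫ p.s := by
  rw [compS_def, ← Category.assoc, map_δ, Category.assoc, ← Category.assoc (W.map _ _ _ _ _),
    map_map]
  congr 2
  refine map_congr (Category.comp_id _) ?_ _
  rw [compW_def, ← Category.assoc, map_map]
  congr 1
  exact map_congr rfl (Category.comp_id _) _

theorem vid_vcomp {X Y : C} (p : W.RAlg X Y) : vcomp (RAlg.vid W.toPreAWFS X) p = p := by
  refine RAlg.ext' (Category.id_comp _) ?_
  change compS (RAlg.vid W.toPreAWFS X) p = _
  have hs : (RAlg.vid W.toPreAWFS X).s = W.r (𝟙 X) := rfl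
  have hf : (RAlg.vid W.toPreAWFS X).f = 𝟙 X := rfl
  have h := compS_f (RAlg.vid W.toPreAWFS X) p
  have h' : compS (RAlg.vid W.toPreAWFS X) p ≫ 𝟙 X = _ := h
  rw [Category.comp_id] at h'
  rw [h']
  rfl

theorem vcomp_vid {X Y : C} (p : W.RAlg X Y) : vcomp p (RAlg.vid W.toPreAWFS Y) = p := by
  refine RAlg.ext' (Category.comp_id _) ?_
  change compS p (RAlg.vid W.toPreAWFS Y) = _
  have h : compS p (RAlg.vid W.toPreAWFS Y) = W.δ (p.f ≫ 𝟙 Y) ≫ W.map (W.l (p.f ≫ 𝟙 Y)) p.f (𝟙 X)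
      (W.map (p.f ≫ 𝟙 Y) (𝟙 Y) p.f (𝟙 Y) (Category.comp_id _).symm ≫ W.r (𝟙 Y)) _ ≫ p.s := rfl
  have e : W.map (p.f ≫ 𝟙 Y) (𝟙 Y) p.f (𝟙 Y) (Category.comp_id _).symm ≫ W.r (𝟙 Y) =
      W.r (p.f ≫ 𝟙 Y) ≫ 𝟙 Y := map_r _ _ _ _ _ _
  have e₂ : W.map (W.l (p.f ≫ 𝟙 Y)) p.f (𝟙 X) (W.r (p.f ≫ 𝟙 Y) ≫ 𝟙 Y) (by
      rw [← Category.assoc, l_r, Category.id_comp, Category.comp_id, Category.comp_id]) =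
      W.map (W.l (p.f ≫ 𝟙 Y)) (p.f ≫ 𝟙 Y) (𝟙 X) (W.r (p.f ≫ 𝟙 Y))
        ((Category.id_comp _).trans (W.l_r _).symm) ≫
      W.map (p.f ≫ 𝟙 Y) p.f (𝟙 X) (𝟙 Y)
        ((Category.id_comp _).trans ((Category.comp_id _).trans (Category.comp_id _)).symm) := by
    rw [map_map]
    exact map_congr (Category.comp_id _).symm rfl _
  refine h.trans ((congrArg (fun t => W.δ (p.f ≫ 𝟙 Y) ≫ t ≫ p.s)
    ((map_congr rfl e _).trans e₂)).trans ?_)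
  rw [← Category.assoc, ← Category.assoc, δ_map_r, Category.id_comp]
  rfl

theorem vcomp_assoc {X Y Z T : C} (p : W.RAlg X Y) (q : W.RAlg Y Z) (k : W.RAlg Z T) :
    vcomp (vcomp p q) k = vcomp p (vcomp q k) := by
  refine RAlg.ext' (Category.assoc _ _ _) ?_
  have w₀ : 𝟙 X ≫ p.f ≫ q.f ≫ k.f = ((p.f ≫ q.f) ≫ k.f) ≫ 𝟙 T := by
    rw [Category.id_comp, Category.comp_id, Category.assoc]
  have w₁ : (𝟙 X ≫ p.f) ≫ q.f ≫ k.f = ((p.f ≫ q.f) ≫ k.f) ≫ 𝟙 T := by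
    rw [Category.id_comp, Category.comp_id, Category.assoc]
  change compS (vcomp p q) k =
    W.map ((p.f ≫ q.f) ≫ k.f) (p.f ≫ (vcomp q k).f) (𝟙 X) (𝟙 T) w₀ ≫ compS p (vcomp q k)
  refine Eq.trans ?_ (map_compS p (vcomp q k) ((p.f ≫ q.f) ≫ k.f) (𝟙 X) (𝟙 T) w₀).symm
  have h₁ := map_compS q k ((p.f ≫ q.f) ≫ k.f) (𝟙 X ≫ p.f) (𝟙 T) w₁
  have h₂ := map_compS p q (W.l ((p.f ≫ q.f) ≫ k.f)) (𝟙 X) (compW (vcomp p q) k)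
    ((Category.id_comp _).trans (l_compW (vcomp p q) k).symm)
  refine (congrArg (CategoryStruct.comp _) h₂).trans ?_
  refine (Category.assoc _ _ _).symm.trans ?_
  refine (congrArg (fun t => t ≫ _) (W.δ_map_δ ((p.f ≫ q.f) ≫ k.f)).symm).trans ?_
  refine (Category.assoc _ _ _).trans (congrArg (CategoryStruct.comp _) ?_)
  refine (Category.assoc _ _ _).symm.trans (congrArg (fun t => t ≫ p.s) ?_)
  rw [map_map]
  refine map_congr (Category.comp_id _) (Eq.trans ?_ h₁.symm) _
  congr 2
  refine map_congr rfl ?_ _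
  rw [compW_def]
  congr 1
  refine map_congr ?_ rfl _
  rw [Category.id_comp]
  rfl

theorem hid {X Y : C} (p : W.RAlg X Y) : RAlg.IsSquare (𝟙 X) p p (𝟙 Y) :=
  RAlg.isSquare_iff.2 ⟨(Category.id_comp _).trans (Category.comp_id _).symm, by
    rw [map_id, Category.id_comp, Category.comp_id]⟩

theorem sqVid {X X' : C} (f : X ⟶ X') :
    RAlg.IsSquare f (RAlg.vid W.toPreAWFS X) (RAlg.vid W.toPreAWFS X') f :=
  RAlg.isSquare_iff.2 ⟨(Category.comp_id _).trans (Category.id_comp _).symm,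
    W.map_r (𝟙 X) (𝟙 X') f f ((Category.comp_id _).trans (Category.id_comp _).symm)⟩

theorem sqHcomp {X Y X' Y' X'' Y'' : C} {a : X ⟶ X'} {a' : X' ⟶ X''} {b : Y ⟶ Y'} {b' : Y' ⟶ Y''}
    {p : W.RAlg X Y} {q : W.RAlg X' Y'} {r : W.RAlg X'' Y''}
    (α : RAlg.IsSquare a p q b) (β : RAlg.IsSquare a' q r b') :
    RAlg.IsSquare (a ≫ a') p r (b ≫ b') := by
  obtain ⟨w, h⟩ := RAlg.isSquare_iff.1 α
  obtain ⟨w', h'⟩ := RAlg.isSquare_iff.1 β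
  refine RAlg.isSquare_iff.2 ⟨by rw [Category.assoc, w', ← Category.assoc, w, Category.assoc], ?_⟩
  rw [← map_map _ p.f q.f r.f a b a' b' w w', Category.assoc, h', ← Category.assoc, h,
    Category.assoc]

theorem sqVcomp {X Y Z X' Y' Z' : C} {a : X ⟶ X'} {b : Y ⟶ Y'} {c : Z ⟶ Z'}
    {p : W.RAlg X Y} {p' : W.RAlg X' Y'} {q : W.RAlg Y Z} {q' : W.RAlg Y' Z'}
    (α : RAlg.IsSquare a p p' b) (β : RAlg.IsSquare b q q' c) :
    RAlg.IsSquare a (vcomp p q) (vcomp p' q') c := by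
  obtain ⟨w, h⟩ := RAlg.isSquare_iff.1 α
  obtain ⟨w', h'⟩ := RAlg.isSquare_iff.1 β
  have w₂ : a ≫ p'.f ≫ q'.f = (p.f ≫ q.f) ≫ c := by
    rw [← Category.assoc, w, Category.assoc, w', Category.assoc]
  refine RAlg.isSquare_iff.2 ⟨w₂, ?_⟩
  change W.map (p.f ≫ q.f) (p'.f ≫ q'.f) a c w₂ ≫ compS p' q' = compS p q ≫ a
  refine (map_compS p' q' (p.f ≫ q.f) a c w₂).trans ?_
  rw [compS_def, Category.assoc (W.δ _), Category.assoc (W.map _ _ _ _ _), ← h, ← Category.assoc (W.map _ _ _ _ _),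
    map_map]
  congr 2
  refine map_congr (Category.id_comp _).symm ?_ _
  rw [compW_def, Category.assoc (W.map _ _ _ _ _), ← h',
    ← Category.assoc (W.map _ _ _ _ _), map_map]
  congr 1
  exact map_congr w (Category.id_comp _).symm _

end AWFS

/-- The double category of algebras of an algebraic weak factorisation system. -/
def algDouble (W : AWFS C) : DoubleCat.{u, v, v, 0} where
  Obj := C
  Ver X Y := W.RAlg X Y
  vid X := PreAWFS.RAlg.vid W.toPreAWFS X
  vcomp p q := AWFS.vcomp p q
  vid_vcomp p := AWFS.vid_vcomp p
  vcomp_vid p := AWFS.vcomp_vid p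
  vcomp_assoc p q r := AWFS.vcomp_assoc p q r
  Sq t l r b := PreAWFS.RAlg.IsSquare t l r b
  sqHid p := AWFS.hid p
  sqVid f := AWFS.sqVid f
  sqHcomp α β := AWFS.sqHcomp α β
  sqVcomp α β := AWFS.sqVcomp α β
  hid_hcomp _ := proof_irrel_heq _ _
  hcomp_hid _ := proof_irrel_heq _ _
  hcomp_assoc _ _ _ := proof_irrel_heq _ _
  vid_sqVcomp _ := proof_irrel_heq _ _
  sqVcomp_vid _ := proof_irrel_heq _ _
  sqVcomp_assoc _ _ _ := proof_irrel_heq _ _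
  sqHid_vid _ := rfl
  sqHid_vcomp _ _ := rfl
  sqVid_comp _ _ := rfl
  interchange _ _ _ _ := rfl

/-- The forgetful double functor. -/
def algForget (W : AWFS C) : DoubleFunctor (algDouble W) (sqDouble C) where
  obj X := X
  hor f := f
  ver p := p.f
  sq α := α.comm
  hor_id _ := rfl
  hor_comp _ _ := rfl
  ver_vid _ := rfl
  ver_vcomp _ _ := rfl
  sq_hid _ := proof_irrel_heq _ _
  sq_vid _ := proof_irrel_heq _ _
  sq_hcomp _ _ := proof_irrel_heq _ _
  sq_vcomp _ _ := proof_irrel_heq _ _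

/-- The awfs `W` is cofibrantly generated by `U : J → Sq(C)`: its double category of algebras is
isomorphic over `Sq(C)` to that of morphisms with a right lifting operation against `U`. -/
def AWFS.CofibrantlyGeneratedBy (W : AWFS C) {J : DoubleCat.{o, h, w, s}}
    (U : DoubleFunctor J (sqDouble C)) : Prop :=
  DoubleFunctor.IsoOver (algForget W) (liftForget U)

end AWFS

/-- An object `A` is `ω`-small if `C(A, -)` preserves colimits of `ω`-chains, that is, of functors
`ℕ ⥤ C`. -/
def IsOmegaSmall {C : Type u} [Category.{v} C] (A : C) : Prop :=
  Limits.PreservesColimitsOfShape ℕ (coyoneda.obj (Opposite.op A))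

/-! The theorem reduces to the existence, for each `f : X ⟶ Y`, of a free lifting structure: a
factorisation of `f` as `l` followed by a map to `Y` with a lifting operation, initial among all
squares from `f` to maps with a lifting operation (`FreeLift`).

Existence is a small object argument in which all relations are imposed at once. A stage is an
object over `Y` with a chosen extension of every square out of `f` (a "test"). The next stage
adjoins freely a solution to each lifting problem and then identifies any two maps from an object
`UA` that no test distinguishes. By `ω`-smallness every map from `UA` into the colimit of the stages
factors through a stage, so lifting problems have solutions there (`exists_lift`), and the tests are
jointly monic on maps from `UA` (`limE_ext`). Every law of a lifting operation therefore holds in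
the colimit because it holds in the target of each test. Freeness follows by induction on the stages
(`freeLift`).

Given free structures, `Lf` and `Rf` are the two factors. The multiplication is induced by the
identity of `Rf`, and the comultiplication by the vertical composite of the free structures on `Lf`
and `f`. Each axiom, including the distributive law, equates two maps out of a free structure that
are compatible with the lifting operations and agree along `l` (`FreeLift.hom_ext`).

An algebra structure on `f` transports the operation of its free structure to `f`; conversely an
operation on `f` induces a map out of the free structure. The operation is determined by
compatibility with the structure map (`toLiftMor_eq`), which shows that these passages are inverse
and respect vertical composition. -/

/-! ## Free lifting structures -/

section FreeLifting

variable {C : Type u} [Category.{v} C]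

/-- A commutative square from `f` to a morphism with a lifting operation. -/
structure LiftCone {J : DoubleCat.{o, h, w, s}} (U : DoubleFunctor J (sqDouble C)) {X Y : C}
    (f : X ⟶ Y) where
  {dom : C}
  {cod : C}
  q : LiftMor U dom cod
  b : X ⟶ dom
  c : Y ⟶ cod
  w : b ≫ q.f = f ≫ c

/-- The square from `f` to the identity of its codomain. -/
def LiftCone.vid {J : DoubleCat.{o, h, w, s}} (U : DoubleFunctor J (sqDouble C)) {X Y : C}
    (f : X ⟶ Y) : LiftCone U f where
  q := LiftMor.vid U Y
  b := f
  c := 𝟙 Y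
  w := rfl

/-- The free morphism with a lifting operation on `f`, with the same codomain. -/
structure FreeLift {J : DoubleCat.{o, h, w, s}} (U : DoubleFunctor J (sqDouble C)) {X Y : C}
    (f : X ⟶ Y) where
  E : C
  l : X ⟶ E
  q : LiftMor U E Y
  fac : l ≫ q.f = f
  desc : ∀ τ : LiftCone U f, E ⟶ τ.dom
  l_desc : ∀ τ, l ≫ desc τ = τ.b
  isSquare : ∀ τ, LiftMor.IsSquare (desc τ) q τ.q τ.c
  uniq : ∀ (τ : LiftCone U f) (k : E ⟶ τ.dom), l ≫ k = τ.b →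
    LiftMor.IsSquare k q τ.q τ.c → k = desc τ

/-! ### Stages, and the passage from one stage to the next. -/

variable {J : DoubleCat.{v, v, v, v + 1}} (U : DoubleFunctor J (sqDouble C))

/-- An approximation to the free lifting structure on `f`: an object over the codomain of `f`
through which every square from `f` to a morphism with a lifting operation extends in a specified
way. -/
structure FreeStage {X Y : C} (f : X ⟶ Y) where
  E : C
  p : E ⟶ Y
  test : ∀ τ : LiftCone U f, E ⟶ τ.dom
  test_f : ∀ τ : LiftCone U f, test τ ≫ τ.q.f = p ≫ τ.c

namespace FreeStage

variable {U} {X Y : C} {f : X ⟶ Y} (S : FreeStage U f)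

/-- The lifting problems against `S.p`. -/
structure Problem where
  {A : J.Obj}
  {B : J.Obj}
  j : J.Ver A B
  x : U.ob A ⟶ S.E
  y : U.ob B ⟶ Y
  e : x ≫ S.p = U.vmor j ≫ y

variable {S} in
theorem Problem.test_e (i : S.Problem) (τ : LiftCone U f) :
    (i.x ≫ S.test τ) ≫ τ.q.f = U.vmor i.j ≫ i.y ≫ τ.c := by
  rw [Category.assoc, S.test_f, ← Category.assoc, i.e, Category.assoc]

/-- The solution of a lifting problem against the target of a square. -/
def solve (i : S.Problem) (τ : LiftCone U f) : U.ob i.B ⟶ τ.dom :=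
  τ.q.lift i.j (i.x ≫ S.test τ) (i.y ≫ τ.c) (i.test_e τ)

theorem solve_f (i : S.Problem) (τ : LiftCone U f) : S.solve i τ ≫ τ.q.f = i.y ≫ τ.c :=
  τ.q.right_fac _ _ _ _

variable [Limits.HasColimits C]

open Limits

/-- The next stage before taking the quotient. -/
noncomputable def sum : C := S.E ⨿ ∐ fun i : S.Problem => U.ob i.B

noncomputable def inl : S.E ⟶ S.sum := coprod.inl

noncomputable def inr (i : S.Problem) : U.ob i.B ⟶ S.sum :=
  Sigma.ι (fun i : S.Problem => U.ob i.B) i ≫ coprod.inr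

noncomputable def sumDesc {T : C} (a : S.E ⟶ T) (b : ∀ i : S.Problem, U.ob i.B ⟶ T) : S.sum ⟶ T :=
  coprod.desc a (Sigma.desc b)

theorem inl_sumDesc {T : C} (a : S.E ⟶ T) (b : ∀ i : S.Problem, U.ob i.B ⟶ T) :
    S.inl ≫ S.sumDesc a b = a := coprod.inl_desc _ _

theorem inr_sumDesc {T : C} (a : S.E ⟶ T) (b : ∀ i : S.Problem, U.ob i.B ⟶ T) (i : S.Problem) :
    S.inr i ≫ S.sumDesc a b = b i := by
  refine (Category.assoc _ _ _).trans ?_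
  refine (congrArg (Sigma.ι (fun i : S.Problem => U.ob i.B) i ≫ ·) (coprod.inr_desc _ _)).trans ?_
  exact Sigma.ι_desc _ _

theorem sum_hom_ext {T : C} {a b : S.sum ⟶ T} (hl : S.inl ≫ a = S.inl ≫ b)
    (hr : ∀ i, S.inr i ≫ a = S.inr i ≫ b) : a = b := by
  refine coprod.hom_ext hl (Sigma.hom_ext _ _ fun i => ?_)
  exact (Category.assoc _ _ _).symm.trans ((hr i).trans (Category.assoc _ _ _))

noncomputable def sumTest (τ : LiftCone U f) : S.sum ⟶ τ.dom :=
  S.sumDesc (S.test τ) fun i => S.solve i τ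

/-- The pairs of maps out of an object of `J` that are to be identified. -/
structure Rel where
  A : J.Obj
  fst : U.ob A ⟶ S.sum
  snd : U.ob A ⟶ S.sum
  -- The squares `τ` form a large class, but this field is a proposition, so `Rel` still lies in
  -- `Type v` and the coproduct over it exists.
  eq : ∀ τ, fst ≫ S.sumTest τ = snd ≫ S.sumTest τ

noncomputable def relFst : (∐ fun r : S.Rel => U.ob r.A) ⟶ S.sum := Sigma.desc fun r => r.fst

noncomputable def relSnd : (∐ fun r : S.Rel => U.ob r.A) ⟶ S.sum := Sigma.desc fun r => r.snd

theorem relFst_comp_eq {T : C} {g : S.sum ⟶ T} (hg : ∀ r : S.Rel, r.fst ≫ g = r.snd ≫ g) :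
    S.relFst ≫ g = S.relSnd ≫ g := by
  refine Sigma.hom_ext _ _ fun r => ?_
  rw [relFst, relSnd, ← Category.assoc, ← Category.assoc, Sigma.ι_desc, Sigma.ι_desc]
  exact hg r

/-- The object in which the lifting problems of `S` are solved. -/
noncomputable def nextE : C := coequalizer S.relFst S.relSnd

noncomputable def proj : S.sum ⟶ S.nextE := coequalizer.π S.relFst S.relSnd

theorem rel_proj (r : S.Rel) : r.fst ≫ S.proj = r.snd ≫ S.proj := by
  have h : S.relFst ≫ S.proj = S.relSnd ≫ S.proj := coequalizer.condition _ _
  have h' : Sigma.ι (fun r : S.Rel => U.ob r.A) r ≫ S.relFst ≫ S.proj =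
    Sigma.ι (fun r : S.Rel => U.ob r.A) r ≫ S.relSnd ≫ S.proj := by rw [h]
  rwa [relFst, relSnd, ← Category.assoc, ← Category.assoc, Sigma.ι_desc, Sigma.ι_desc] at h'

noncomputable def nextDesc {T : C} (g : S.sum ⟶ T) (hg : ∀ r : S.Rel, r.fst ≫ g = r.snd ≫ g) :
    S.nextE ⟶ T :=
  coequalizer.desc g (S.relFst_comp_eq hg)

theorem proj_nextDesc {T : C} (g : S.sum ⟶ T) (hg : ∀ r : S.Rel, r.fst ≫ g = r.snd ≫ g) :
    S.proj ≫ S.nextDesc g hg = g :=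
  coequalizer.π_desc _ _

theorem nextE_hom_ext {T : C} {a b : S.nextE ⟶ T} (hab : S.proj ≫ a = S.proj ≫ b) : a = b :=
  coequalizer.hom_ext hab

/-- The projection to `Y` is itself a test: for the square into the identity of `Y`, the equation
`test_f` has identities on both sides. Hence the identifications in `Rel` automatically respect the
projection, and `nextP` is well defined. -/
theorem sumTest_vid : (show S.sum ⟶ Y from S.sumTest (LiftCone.vid U f)) =
    S.sumDesc S.p fun i => i.y := by
  refine S.sum_hom_ext ?_ fun i => ?_
  · refine (S.inl_sumDesc _ _).trans (Eq.trans ?_ (S.inl_sumDesc _ _).symm)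
    refine (Category.comp_id _).symm.trans ?_
    exact (S.test_f (LiftCone.vid U f)).trans (Category.comp_id _)
  · refine (S.inr_sumDesc _ _ _).trans (Eq.trans ?_ (S.inr_sumDesc _ _ _).symm)
    exact Category.comp_id _

theorem rel_sumDesc (r : S.Rel) : (r.fst ≫ S.sumDesc S.p fun i => i.y) =
    r.snd ≫ S.sumDesc S.p fun i => i.y := by
  rw [← sumTest_vid]
  exact r.eq _

/-- The map from the next stage to the codomain of `f`. -/
noncomputable def nextP : S.nextE ⟶ Y :=
  S.nextDesc (S.sumDesc S.p fun i => i.y) S.rel_sumDesc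

/-- The extension to the next stage of a square from `f`. -/
noncomputable def nextTest (τ : LiftCone U f) : S.nextE ⟶ τ.dom :=
  S.nextDesc (S.sumTest τ) fun r => r.eq τ

theorem proj_nextP : S.proj ≫ S.nextP = S.sumDesc S.p fun i => i.y := S.proj_nextDesc _ _

theorem proj_nextTest (τ : LiftCone U f) : S.proj ≫ S.nextTest τ = S.sumTest τ :=
  S.proj_nextDesc _ _

/-- The stage in which the lifting problems of `S` are solved. -/
noncomputable def next : FreeStage U f where
  E := S.nextE
  p := S.nextP
  test := S.nextTest
  test_f τ := by
    refine S.nextE_hom_ext (S.sum_hom_ext ?_ fun i => ?_)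
    · rw [← Category.assoc S.proj, ← Category.assoc S.proj, proj_nextP, proj_nextTest,
        sumTest, ← Category.assoc, ← Category.assoc, inl_sumDesc, inl_sumDesc, test_f]
    · rw [← Category.assoc S.proj, ← Category.assoc S.proj, proj_nextP, proj_nextTest,
        sumTest, ← Category.assoc, ← Category.assoc, inr_sumDesc, inr_sumDesc, solve_f]

/-- The map from a stage to the next. -/
noncomputable def e : S.E ⟶ S.next.E := S.inl ≫ S.proj

/-- The solutions of lifting problems in the next stage. -/
noncomputable def fill (i : S.Problem) : U.ob i.B ⟶ S.next.E := S.inr i ≫ S.proj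

theorem e_test (τ : LiftCone U f) : S.e ≫ S.next.test τ = S.test τ := by
  refine (Category.assoc _ _ _).trans ((congrArg (S.inl ≫ ·) (S.proj_nextTest τ)).trans ?_)
  exact S.inl_sumDesc _ _

theorem fill_test (i : S.Problem) (τ : LiftCone U f) :
    S.fill i ≫ S.next.test τ = S.solve i τ := by
  refine (Category.assoc _ _ _).trans ((congrArg (S.inr i ≫ ·) (S.proj_nextTest τ)).trans ?_)
  exact S.inr_sumDesc _ _ _

theorem e_p : S.e ≫ S.next.p = S.p := by
  refine (Category.assoc _ _ _).trans ((congrArg (S.inl ≫ ·) S.proj_nextP).trans ?_)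
  exact S.inl_sumDesc _ _

/-- The next stage is generated by the old one and the adjoined solutions; this drives the induction
proving uniqueness in `freeLift`. -/
theorem next_hom_ext {T : C} {a b : S.next.E ⟶ T} (he : S.e ≫ a = S.e ≫ b)
    (hf : ∀ i, S.fill i ≫ a = S.fill i ≫ b) : a = b :=
  S.nextE_hom_ext (S.sum_hom_ext
    ((Category.assoc _ _ _).symm.trans (he.trans (Category.assoc _ _ _)))
    fun i => (Category.assoc _ _ _).symm.trans ((hf i).trans (Category.assoc _ _ _)))

/-- Tests on the sum restrict along `inl` to the tests of the stage, so such a pair becomes a member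
of `Rel` and is identified in the quotient. -/
theorem comp_e_eq {A : J.Obj} {a b : U.ob A ⟶ S.E} (hab : ∀ τ, a ≫ S.test τ = b ≫ S.test τ) :
    a ≫ S.e = b ≫ S.e := by
  have h := S.rel_proj ⟨A, a ≫ S.inl, b ≫ S.inl, fun τ => by
    rw [sumTest, Category.assoc, Category.assoc, inl_sumDesc, hab]⟩
  exact (Category.assoc _ _ _).symm.trans (h.trans (Category.assoc _ _ _))

/-! ### The chain of stages and its colimit. -/

variable (U f) in
/-- The stages of the construction of the free lifting structure. -/
noncomputable def stage : ℕ → FreeStage U f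
  | 0 => { E := X, p := f, test := fun τ => τ.b, test_f := fun τ => τ.w }
  | n + 1 => (stage n).next

-- This is `e` with its target indexed by `n + 1`, the form that `Functor.ofSequence` takes.
variable (U f) in
noncomputable def stageMap (n : ℕ) : (stage U f n).E ⟶ (stage U f (n + 1)).E := (stage U f n).e

variable (U f) in
/-- The sequence of stages. -/
noncomputable def seq : ℕ ⥤ C :=
  Functor.ofSequence (X := fun n => (stage U f n).E) (stageMap U f)

variable (U f) in
noncomputable def limE : C := colimit (seq U f)

variable (U f) in
noncomputable def ι (n : ℕ) : (stage U f n).E ⟶ limE U f := colimit.ι (seq U f) n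

theorem stageMap_ι (n : ℕ) : stageMap U f n ≫ ι U f (n + 1) = ι U f n := by
  have h : (seq U f).map (homOfLE (Nat.le_add_right n 1)) = stageMap U f n :=
    Functor.ofSequence_map_homOfLE_succ _ _
  rw [← h]
  exact colimit.w (seq U f) (homOfLE (Nat.le_add_right n 1))

theorem limE_hom_ext {T : C} {a b : limE U f ⟶ T} (hab : ∀ n, ι U f n ≫ a = ι U f n ≫ b) :
    a = b := colimit.hom_ext hab

noncomputable def limDesc {T : C} (t : ∀ n, (stage U f n).E ⟶ T)
    (ht : ∀ n, stageMap U f n ≫ t (n + 1) = t n) : limE U f ⟶ T :=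
  colimit.desc (seq U f) ⟨T, NatTrans.ofSequence t fun n => by
    have h : (seq U f).map (homOfLE (Nat.le_add_right n 1)) = stageMap U f n :=
      Functor.ofSequence_map_homOfLE_succ _ _
    rw [h]
    exact (ht n).trans (Category.comp_id _).symm⟩

theorem ι_limDesc {T : C} (t : ∀ n, (stage U f n).E ⟶ T)
    (ht : ∀ n, stageMap U f n ≫ t (n + 1) = t n) (n : ℕ) : ι U f n ≫ limDesc t ht = t n :=
  colimit.ι_desc _ _

noncomputable def limTest (τ : LiftCone U f) : limE U f ⟶ τ.dom :=
  limDesc (fun n => (stage U f n).test τ) fun n => (stage U f n).e_test τ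

theorem ι_limTest (n : ℕ) (τ : LiftCone U f) : ι U f n ≫ limTest τ = (stage U f n).test τ :=
  ι_limDesc _ _ _

variable (U f) in
noncomputable def limP : limE U f ⟶ Y :=
  limDesc (fun n => (stage U f n).p) fun n => (stage U f n).e_p

theorem ι_limP (n : ℕ) : ι U f n ≫ limP U f = (stage U f n).p := ι_limDesc _ _ _

theorem limTest_f (τ : LiftCone U f) : limTest τ ≫ τ.q.f = limP U f ≫ τ.c := by
  refine limE_hom_ext fun n => ?_
  rw [← Category.assoc, ← Category.assoc, ι_limTest, ι_limP, test_f]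

/-- This is where smallness enters, and only through surjectivity of the comparison map. Its
injectivity is not called on: equalities of maps into the colimit come from the identifications made
at each stage. -/
theorem exists_ι {A : C} (hA : IsOmegaSmall A) (x : A ⟶ limE U f) :
    ∃ (n : ℕ) (x' : A ⟶ (stage U f n).E), x' ≫ ι U f n = x := by
  have : PreservesColimitsOfShape ℕ (coyoneda.obj (Opposite.op A)) := hA
  exact Types.jointly_surjective_of_isColimit
    (isColimitOfPreserves (coyoneda.obj (Opposite.op A)) (colimit.isColimit (seq U f))) x

theorem exists_comp_ι {A : C} {n m : ℕ} (h : n ≤ m) (x : A ⟶ (stage U f n).E) :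
    ∃ x' : A ⟶ (stage U f m).E, x' ≫ ι U f m = x ≫ ι U f n := by
  induction m, h using Nat.le_induction with
  | base => exact ⟨x, rfl⟩
  | succ m _ ih =>
    obtain ⟨x', hx'⟩ := ih
    exact ⟨x' ≫ stageMap U f m, by rw [Category.assoc, stageMap_ι, hx']⟩

/-- The squares out of `f` are jointly monic on maps from objects of `J` into the colimit. -/
theorem limE_ext {A : J.Obj} (hA : IsOmegaSmall (U.ob A)) {a b : U.ob A ⟶ limE U f}
    (hab : ∀ τ, a ≫ limTest τ = b ≫ limTest τ) : a = b := by
  obtain ⟨n, a, rfl⟩ := exists_ι hA a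
  obtain ⟨m, b, rfl⟩ := exists_ι hA b
  -- Both maps are moved to a common stage. The tests agree there, so the map to the following stage
  -- identifies them.
  obtain ⟨a', ha⟩ := exists_comp_ι (le_max_left n m) a
  obtain ⟨b', hb⟩ := exists_comp_ι (le_max_right n m) b
  rw [← ha, ← hb] at hab ⊢
  simp only [Category.assoc, ι_limTest] at hab
  have h : a' ≫ stageMap U f _ = b' ≫ stageMap U f _ := comp_e_eq _ hab
  rw [← stageMap_ι, ← Category.assoc, h, Category.assoc]

variable (U f) in
/-- The solutions of the lifting problems of a stage in the colimit. -/
noncomputable def limFill (n : ℕ) (i : (stage U f n).Problem) : U.ob i.B ⟶ limE U f :=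
  (show U.ob i.B ⟶ (stage U f (n + 1)).E from (stage U f n).fill i) ≫ ι U f (n + 1)

theorem limFill_limTest (n : ℕ) (i : (stage U f n).Problem) (τ : LiftCone U f) :
    limFill U f n i ≫ limTest τ = (stage U f n).solve i τ := by
  rw [limFill, Category.assoc, ι_limTest]
  exact (stage U f n).fill_test i τ

theorem limTest_e {A B : J.Obj} {j : J.Ver A B} {x : U.ob A ⟶ limE U f} {y : U.ob B ⟶ Y}
    (e : x ≫ limP U f = U.vmor j ≫ y) (τ : LiftCone U f) :
    (x ≫ limTest τ) ≫ τ.q.f = U.vmor j ≫ y ≫ τ.c := by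
  rw [Category.assoc, limTest_f, ← Category.assoc, e, Category.assoc]

theorem exists_lift {A B : J.Obj} (hA : IsOmegaSmall (U.ob A)) (j : J.Ver A B)
    (x : U.ob A ⟶ limE U f) (y : U.ob B ⟶ Y) (e : x ≫ limP U f = U.vmor j ≫ y) :
    ∃ z : U.ob B ⟶ limE U f, z ≫ limP U f = y ∧ ∀ τ,
      z ≫ limTest τ = τ.q.lift j (x ≫ limTest τ) (y ≫ τ.c) (limTest_e e τ) := by
  obtain ⟨n, x, rfl⟩ := exists_ι hA x
  -- The problem is posed at a stage through which `x` factors, and its adjoined solution is taken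
  -- from stage `n + 1`.
  let i : (stage U f n).Problem := ⟨j, x, y, by rw [← e, Category.assoc, ι_limP]⟩
  refine ⟨limFill U f n i, ?_, fun τ => ?_⟩
  -- The lower triangle is the test at the identity of `Y`, whose extension to the colimit is
  -- `limP`.
  · have h : limTest (LiftCone.vid U f) = limP U f := by
      refine (Category.comp_id _).symm.trans ?_
      exact (limTest_f (LiftCone.vid U f)).trans (Category.comp_id _)
    rw [← h]
    exact (limFill_limTest n i _).trans (Category.comp_id _)
  · refine (limFill_limTest n i τ).trans (τ.q.lift_congr _ ?_ rfl _ _)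
    rw [Category.assoc, ι_limTest]

end FreeStage

/-! ### The lifting operation on the colimit and its freeness. -/

section

open FreeStage

variable {U} [Limits.HasColimits C] (hU : ∀ A : J.Obj, IsOmegaSmall (U.ob A)) {X Y : C} (f : X ⟶ Y)

/-- The lifting operation on the colimit of the stages. -/
noncomputable def freeLiftMor : LiftMor U (limE U f) Y where
  f := limP U f
  -- The choice is harmless: the tests of the filler are prescribed, and by `limE_ext` they
  -- determine it. The equational laws below between maps into the colimit are checked after each
  -- test, where they become laws of `τ.q`.
  lift {A _} j x y e := (exists_lift (hU A) j x y e).choose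
  left_fac {A B} j x y e := limE_ext (hU A) fun τ => by
    rw [Category.assoc, (exists_lift (hU A) j x y e).choose_spec.2, τ.q.left_fac]
  right_fac {A B} j x y e := (exists_lift (hU A) j x y e).choose_spec.1
  horizontal {A B A' B' t i j b} α x y e e' := limE_ext (hU B) fun τ => by
    rw [Category.assoc, (exists_lift (hU A') j x y e).choose_spec.2,
      (exists_lift (hU A) i _ _ e').choose_spec.2, ← τ.q.horizontal α]
    · exact τ.q.lift_congr _ (Category.assoc _ _ _) (Category.assoc _ _ _) _ _
    · have := limTest_e e' τ
      simpa only [Category.assoc] using this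
  vertical {A B D} i j x y e e₁ e₂ := limE_ext (hU D) fun τ => by
    have h₁ : (x ≫ limTest τ) ≫ τ.q.f = U.vmor i ≫ U.vmor j ≫ y ≫ τ.c := by
      simpa only [Category.assoc] using limTest_e e₁ τ
    rw [(exists_lift (hU B) j _ _ e₂).choose_spec.2,
      (exists_lift (hU A) (J.vcomp i j) _ _ e).choose_spec.2,
      ← τ.q.vertical i j _ _ (limTest_e e τ) h₁ (τ.q.right_fac _ _ _ _)]
    refine τ.q.lift_congr _ ?_ rfl _ _
    rw [(exists_lift (hU A) i _ _ e₁).choose_spec.2]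
    exact τ.q.lift_congr _ rfl (Category.assoc _ _ _) _ _

theorem freeLiftMor_f : (freeLiftMor hU f).f = limP U f := rfl

theorem freeLiftMor_lift {A B : J.Obj} (j : J.Ver A B) (x : U.ob A ⟶ limE U f) (y : U.ob B ⟶ Y)
    (e : x ≫ limP U f = U.vmor j ≫ y) (τ : LiftCone U f) :
    (freeLiftMor hU f).lift j x y e ≫ limTest τ =
      τ.q.lift j (x ≫ limTest τ) (y ≫ τ.c) (limTest_e e τ) :=
  (exists_lift (hU A) j x y e).choose_spec.2 τ

/-- Both maps have the same tests. The adjoined solutions are thus values of the lifting operation,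
so a map compatible with that operation is forced on them. -/
theorem limFill_eq (n : ℕ) (i : (stage U f n).Problem)
    (e : (i.x ≫ ι U f n) ≫ limP U f = U.vmor i.j ≫ i.y) :
    limFill U f n i = (freeLiftMor hU f).lift i.j (i.x ≫ ι U f n) i.y e :=
  limE_ext (hU _) fun τ => by
    rw [freeLiftMor_lift, limFill_limTest]
    refine τ.q.lift_congr _ ?_ rfl _ _
    rw [Category.assoc, ι_limTest]

/-- The free lifting structure on `f`. -/
noncomputable def freeLift : FreeLift U f where
  E := limE U f
  l := ι U f 0
  q := freeLiftMor hU f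
  fac := ι_limP 0
  desc := limTest
  l_desc := ι_limTest 0
  isSquare τ := ⟨limTest_f τ, fun j x y e _ => freeLiftMor_lift hU f j x y e τ⟩
  uniq τ k hk hs := by
    refine limE_hom_ext fun n => ?_
    rw [ι_limTest]
    induction n with
    | zero => exact hk
    | succ n ih =>
      -- On the old stage the induction hypothesis applies. On an adjoined solution, compatibility
      -- sends it to the chosen filler in the target, which is how the test is defined there.
      refine (stage U f n).next_hom_ext ?_ fun i => ?_
      · refine (Category.assoc _ _ _).symm.trans ?_
        refine (congrArg (· ≫ k) (stageMap_ι n)).trans (ih.trans ?_)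
        exact ((stage U f n).e_test τ).symm
      · have e : (i.x ≫ ι U f n) ≫ limP U f = U.vmor i.j ≫ i.y := by
          rw [Category.assoc, ι_limP, i.e]
        have e' : ((i.x ≫ ι U f n) ≫ k) ≫ τ.q.f = U.vmor i.j ≫ i.y ≫ τ.c := by
          rw [Category.assoc, hs.comm, freeLiftMor_f, ← Category.assoc, e, Category.assoc]
        refine (Category.assoc _ _ _).symm.trans ?_
        refine (congrArg (· ≫ k) (limFill_eq hU f n i e)).trans ?_
        refine (hs.lift_comp _ _ _ _ e').trans ?_
        refine Eq.trans (τ.q.lift_congr _ ?_ rfl _ _) ((stage U f n).fill_test i τ).symm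
        rw [Category.assoc, ih]

end

end FreeLifting

/-! ## The algebraic weak factorisation system of free lifting structures -/

section FreeAWFS

variable {C : Type u} [Category.{v} C] {J : DoubleCat.{o, h, w, s}}
  {U : DoubleFunctor J (sqDouble C)}

/-! ### Pasting squares that have identity edges. -/

namespace LiftMor

/-- Pasting produces boundaries such as `b ≫ 𝟙 _` or `p.vcomp (vid _)`; this replaces them by their
simplified forms. -/
theorem IsSquare.of_eq {X Y X' Y' : C} {a a' : X ⟶ X'} {p : LiftMor U X Y} {q q' : LiftMor U X' Y'}
    {b b' : Y ⟶ Y'} (α : IsSquare a p q b) (ha : a = a') (hq : q = q') (hb : b = b') :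
    IsSquare a' p q' b' := by
  subst ha hq hb
  exact α

/-- Horizontal pasting along squares with identity bottom. -/
theorem IsSquare.hcomp_id {X X' Y X'' Y' : C} {a : X ⟶ X'} {a' : X' ⟶ X''} {b : Y ⟶ Y'}
    {p : LiftMor U X Y} {q : LiftMor U X' Y'} {r : LiftMor U X'' Y'}
    (α : IsSquare a p q b) (β : IsSquare a' q r (𝟙 Y')) : IsSquare (a ≫ a') p r b :=
  (α.hcomp β).of_eq rfl rfl (Category.comp_id b)

theorem IsSquare.id_hcomp {X X' Y X'' Y' : C} {a : X ⟶ X'} {a' : X' ⟶ X''} {b : Y ⟶ Y'}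
    {p : LiftMor U X Y} {q : LiftMor U X' Y} {r : LiftMor U X'' Y'}
    (α : IsSquare a p q (𝟙 Y)) (β : IsSquare a' q r b) : IsSquare (a ≫ a') p r b :=
  (α.hcomp β).of_eq rfl rfl (Category.id_comp b)

/-- A filler against an identity is the bottom edge of the problem, so compatibility is just the
lower triangle `right_fac`. -/
theorem IsSquare.toVid {X Y : C} (p : LiftMor U X Y) : IsSquare p.f p (LiftMor.vid U Y) (𝟙 Y) where
  comm := rfl
  lift_comp j x y e _ := (p.right_fac j x y e).trans (Category.comp_id y).symm

theorem vcomp_vid {X Y : C} (p : LiftMor U X Y) : p.vcomp (LiftMor.vid U Y) = p :=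
  (liftDouble U).vcomp_vid p

theorem vid_vcomp {X Y : C} (p : LiftMor U X Y) : (LiftMor.vid U X).vcomp p = p :=
  (liftDouble U).vid_vcomp p

theorem vcomp_assoc {X Y Z T : C} (p : LiftMor U X Y) (q : LiftMor U Y Z) (r : LiftMor U Z T) :
    (p.vcomp q).vcomp r = p.vcomp (q.vcomp r) :=
  (liftDouble U).vcomp_assoc p q r

/-- The square from a vertical composite to its second factor. -/
theorem IsSquare.vcomp_snd {X Y Z : C} (p : LiftMor U X Y) (q : LiftMor U Y Z) :
    IsSquare p.f (p.vcomp q) q (𝟙 Z) :=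
  ((IsSquare.toVid p).vcomp (IsSquare.hid q)).of_eq rfl (vid_vcomp q) rfl

/-- Extension of a square over a map `q.f` along vertical composition with `q`. -/
theorem IsSquare.vcomp_left {X Y Z X' : C} {a : X ⟶ X'} {p : LiftMor U X Y} {q : LiftMor U Y Z}
    {p' : LiftMor U X' Z} (α : IsSquare a p p' q.f) : IsSquare a (p.vcomp q) p' (𝟙 Z) :=
  (α.vcomp (IsSquare.toVid q)).of_eq rfl (vcomp_vid p') rfl

end LiftMor

namespace FreeLift

open LiftMor

section

variable {X Y X' Y' : C} {f : X ⟶ Y} (G : FreeLift U f)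

/-- The map out of the free lifting structure determined by a square. -/
def lift (q : LiftMor U X' Y') (b : X ⟶ X') (c : Y ⟶ Y') (w : b ≫ q.f = f ≫ c) : G.E ⟶ X' :=
  G.desc ⟨q, b, c, w⟩

theorem l_lift (q : LiftMor U X' Y') (b : X ⟶ X') (c : Y ⟶ Y') (w : b ≫ q.f = f ≫ c) :
    G.l ≫ G.lift q b c w = b :=
  G.l_desc ⟨q, b, c, w⟩

theorem lift_isSquare (q : LiftMor U X' Y') (b : X ⟶ X') (c : Y ⟶ Y') (w : b ≫ q.f = f ≫ c) :
    IsSquare (G.lift q b c w) G.q q c :=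
  G.isSquare ⟨q, b, c, w⟩

/-- The uniqueness half of freeness, and the source of the awfs axioms: paste squares to see that
both sides are compatible with the operations, then compare along `l`. -/
theorem hom_ext {G : FreeLift U f} {q : LiftMor U X' Y'} {c : Y ⟶ Y'} {a b : G.E ⟶ X'}
    (ha : IsSquare a G.q q c) (hb : IsSquare b G.q q c) (hab : G.l ≫ a = G.l ≫ b) : a = b := by
  have w : (G.l ≫ b) ≫ q.f = f ≫ c := by
    rw [Category.assoc, hb.comm, ← Category.assoc, G.fac]
  rw [G.uniq ⟨q, G.l ≫ b, c, w⟩ a hab ha]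
  exact (G.uniq ⟨q, G.l ≫ b, c, w⟩ b rfl hb).symm

end

/-! ### The monad, the comonad and the distributive law. -/

variable (F : ∀ ⦃X Y : C⦄ (f : X ⟶ Y), FreeLift U f)

section

variable {X Y X' Y' X'' Y'' : C} (f : X ⟶ Y) (g : X' ⟶ Y') (k : X'' ⟶ Y'')

/-- The functorial action on squares. -/
def map (b : X ⟶ X') (c : Y ⟶ Y') (w : b ≫ g = f ≫ c) : (F f).E ⟶ (F g).E :=
  (F f).lift (F g).q (b ≫ (F g).l) c (by rw [Category.assoc, (F g).fac, w])

theorem l_map (b : X ⟶ X') (c : Y ⟶ Y') (w : b ≫ g = f ≫ c) :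
    (F f).l ≫ map F f g b c w = b ≫ (F g).l :=
  (F f).l_lift _ _ _ _

theorem l_map_assoc (b : X ⟶ X') (c : Y ⟶ Y') (w : b ≫ g = f ≫ c) {T : C} (k : (F g).E ⟶ T) :
    (F f).l ≫ map F f g b c w ≫ k = b ≫ (F g).l ≫ k := by
  rw [← Category.assoc, l_map, Category.assoc]

theorem map_isSquare (b : X ⟶ X') (c : Y ⟶ Y') (w : b ≫ g = f ≫ c) :
    IsSquare (map F f g b c w) (F f).q (F g).q c :=
  (F f).lift_isSquare _ _ _ _

theorem map_id : map F f f (𝟙 X) (𝟙 Y) (by simp) = 𝟙 _ :=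
  hom_ext (map_isSquare _ _ _ _ _ _) (IsSquare.hid _) (by rw [l_map, Category.comp_id,
    Category.id_comp])

theorem map_comp (b : X ⟶ X') (c : Y ⟶ Y') (w : b ≫ g = f ≫ c) (b' : X' ⟶ X'') (c' : Y' ⟶ Y'')
    (w' : b' ≫ k = g ≫ c') (w'' : (b ≫ b') ≫ k = f ≫ c ≫ c') :
    map F f k (b ≫ b') (c ≫ c') w'' = map F f g b c w ≫ map F g k b' c' w' :=
  hom_ext (map_isSquare _ _ _ _ _ _) ((map_isSquare _ _ _ _ _ _).hcomp (map_isSquare _ _ _ _ _ _))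
    (by rw [l_map, l_map_assoc, l_map, Category.assoc])

/-- The multiplication of the monad. -/
def mul : (F (F f).q.f).E ⟶ (F f).E :=
  (F (F f).q.f).lift (F f).q (𝟙 _) (𝟙 _) (by rw [Category.id_comp, Category.comp_id])

theorem l_mul : (F (F f).q.f).l ≫ mul F f = 𝟙 _ := (F (F f).q.f).l_lift _ _ _ _

theorem l_mul_assoc {T : C} (k : (F f).E ⟶ T) : (F (F f).q.f).l ≫ mul F f ≫ k = k := by
  rw [← Category.assoc, l_mul, Category.id_comp]

theorem mul_isSquare : IsSquare (mul F f) (F (F f).q.f).q (F f).q (𝟙 Y) :=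
  (F (F f).q.f).lift_isSquare _ _ _ _

/-- The comultiplication of the comonad. -/
def comul : (F f).E ⟶ (F (F f).l).E :=
  -- The target is `Rf ∘ R(Lf)` with its composite operation, reached from `f` by the square with
  -- top `L(Lf)` and bottom the identity.
  (F f).lift ((F (F f).l).q.vcomp (F f).q) (F (F f).l).l (𝟙 Y) (by
    change _ ≫ (F (F f).l).q.f ≫ (F f).q.f = _
    rw [← Category.assoc, (F (F f).l).fac, (F f).fac, Category.comp_id])

theorem l_comul : (F f).l ≫ comul F f = (F (F f).l).l := (F f).l_lift _ _ _ _

theorem l_comul_assoc {T : C} (k : (F (F f).l).E ⟶ T) :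
    (F f).l ≫ comul F f ≫ k = (F (F f).l).l ≫ k := by
  rw [← Category.assoc, l_comul]

theorem comul_isSquare :
    IsSquare (comul F f) (F f).q ((F (F f).l).q.vcomp (F f).q) (𝟙 Y) :=
  (F f).lift_isSquare _ _ _ _

theorem comul_r : comul F f ≫ (F (F f).l).q.f = 𝟙 _ :=
  hom_ext ((comul_isSquare F f).hcomp_id (IsSquare.vcomp_snd _ _)) (IsSquare.hid _)
    (by rw [l_comul_assoc, (F (F f).l).fac, Category.comp_id])

/-- The bottom edge of the `map` square is `Rf`, which carries the operation `(F f).q`; pasting that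
operation underneath (`vcomp_left`) gives a square from the composite `Rf ∘ R(Lf)` to `Rf`. -/
theorem comul_map_r : comul F f ≫ map F (F f).l f (𝟙 X) (F f).q.f
    (by rw [Category.id_comp, (F f).fac]) = 𝟙 _ :=
  hom_ext ((comul_isSquare F f).hcomp_id (map_isSquare F _ _ _ _ _).vcomp_left) (IsSquare.hid _)
    (by rw [l_comul_assoc, l_map, Category.comp_id, Category.id_comp])

/-- Both sides are squares into the threefold vertical composite of free structures, bracketed
differently; associativity of vertical composition makes the targets equal. -/
theorem comul_map_comul : comul F f ≫ map F (F f).l (F (F f).l).l (𝟙 X) (comul F f)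
    (by rw [Category.id_comp, l_comul]) = comul F f ≫ comul F (F f).l :=
  hom_ext
    ((comul_isSquare F f).hcomp_id ((map_isSquare F _ _ _ _ _).vcomp (comul_isSquare F f)))
    ((comul_isSquare F f).hcomp_id (((comul_isSquare F (F f).l).vcomp (IsSquare.hid _)).of_eq rfl
      (vcomp_assoc _ _ _) rfl))
    (by rw [l_comul_assoc, l_map, l_comul_assoc, l_comul, Category.id_comp])

theorem map_comul (b : X ⟶ X') (c : Y ⟶ Y') (w : b ≫ g = f ≫ c) :
    map F f g b c w ≫ comul F g = comul F f ≫
      map F (F f).l (F g).l b (map F f g b c w) (l_map F f g b c w).symm :=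
  hom_ext ((map_isSquare F f g b c w).hcomp_id (comul_isSquare F g))
    ((comul_isSquare F f).id_hcomp ((map_isSquare F _ _ _ _ _).vcomp (map_isSquare F f g b c w)))
    (by rw [l_map_assoc, l_comul, l_comul_assoc, l_map])

theorem map_mul (b : X ⟶ X') (c : Y ⟶ Y') (w : b ≫ g = f ≫ c) :
    map F (F f).q.f (F g).q.f (map F f g b c w) c (map_isSquare F f g b c w).comm ≫ mul F g =
      mul F f ≫ map F f g b c w :=
  hom_ext ((map_isSquare F _ _ _ _ _).hcomp_id (mul_isSquare F g))
    ((mul_isSquare F f).id_hcomp (map_isSquare F f g b c w))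
    (by rw [l_map_assoc, l_mul, l_mul_assoc, Category.comp_id])

theorem map_l_mul : map F f (F f).q.f (F f).l (𝟙 Y) (by rw [(F f).fac, Category.comp_id]) ≫
    mul F f = 𝟙 _ :=
  hom_ext ((map_isSquare F _ _ _ _ _).hcomp_id (mul_isSquare F f)) (IsSquare.hid _)
    (by rw [l_map_assoc, l_mul])

theorem map_mul_mul : map F (F (F f).q.f).q.f (F f).q.f (mul F f) (𝟙 Y) (mul_isSquare F f).comm ≫
    mul F f = mul F (F f).q.f ≫ mul F f :=
  hom_ext ((map_isSquare F _ _ _ _ _).hcomp_id (mul_isSquare F f))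
    ((mul_isSquare F _).hcomp_id (mul_isSquare F f))
    (by rw [l_map_assoc, l_mul, l_mul_assoc, Category.comp_id])

/-- The distributive law: both sides leave the free structure on `Rf`, land in `Rf ∘ R(Lf)` with its
composite operation, and restrict along `l` to `comul F f`. -/
theorem mul_comul : mul F f ≫ comul F f = comul F (F f).q.f ≫
    map F (F (F f).q.f).l (F (F f).l).q.f (comul F f) (mul F f)
      ((comul_r F f).trans (l_mul F f).symm) ≫ mul F (F f).l :=
  hom_ext ((mul_isSquare F f).hcomp_id (comul_isSquare F f))
    ((comul_isSquare F _).hcomp_id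
      (((map_isSquare F _ _ _ _ _).hcomp_id (mul_isSquare F (F f).l)).vcomp (mul_isSquare F f)))
    (by rw [l_mul_assoc, l_comul_assoc, l_map_assoc, l_mul, Category.comp_id])

end

/-- The functorial factorisation through the free lifting structures. -/
def fact : FunctFact C where
  Z :=
    { obj a := (F a.hom).E
      map {a b} k := map F a.hom b.hom k.left k.right (Arrow.w k)
      map_id a := map_id F a.hom
      map_comp k k' := map_comp F _ _ _ _ _ _ _ _ _ _ }
  i :=
    { app a := (F a.hom).l
      naturality _ _ k := (l_map F _ _ _ _ (Arrow.w k)).symm }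
  p :=
    { app a := (F a.hom).q.f
      naturality _ _ k := (map_isSquare F _ _ _ _ (Arrow.w k)).comm }
  fac := by
    ext a
    exact (F a.hom).fac
  hi _ := trivial
  hp _ := trivial

/-- The comonad and the monad of the free lifting structures. -/
def preAWFS : PreAWFS C where
  fact := fact F
  comul :=
    { app a := Arrow.homMk (f := (fact F).L.obj a) (g := (fact F).L.obj ((fact F).L.obj a))
        (𝟙 a.left) (comul F a.hom) ((Category.id_comp _).trans (l_comul F a.hom).symm)
      naturality a b k := by
        ext
        · exact (Category.comp_id _).trans (Category.id_comp _).symm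
        · exact map_comul F _ _ _ _ (Arrow.w k) }
  left_counit a := by
    ext
    · exact Category.id_comp _
    · exact comul_r F _
  right_counit a := by
    ext
    · exact Category.id_comp _
    · exact comul_map_r F _
  coassoc a := by
    ext
    · rfl
    · exact comul_map_comul F _
  mul :=
    { app a := Arrow.homMk (f := (fact F).R.obj ((fact F).R.obj a)) (g := (fact F).R.obj a)
        (mul F a.hom) (𝟙 a.right) (mul_isSquare F a.hom).comm
      naturality a b k := by
        ext
        · exact map_mul F _ _ _ _ (Arrow.w k)
        · exact (Category.comp_id _).trans (Category.id_comp _).symm }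
  left_unit a := by
    ext
    · exact l_mul F _
    · exact Category.id_comp _
  right_unit a := by
    ext
    · exact map_l_mul F _
    · exact Category.id_comp _
  assoc a := by
    ext
    · exact map_mul_mul F _
    · rfl

/-- The algebraic weak factorisation system of the free lifting structures. -/
def awfs : AWFS C where
  toPreAWFS := preAWFS F
  distrib f := mul_comul F f

end FreeLift

end FreeAWFS

/-! ## Algebras and lifting operations -/

section AlgebraLift

variable {C : Type u} [Category.{v} C] {J : DoubleCat.{o, h, w, s}}
  {U : DoubleFunctor J (sqDouble C)} {F : ∀ ⦃X Y : C⦄ (f : X ⟶ Y), FreeLift U f}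

namespace FreeLift

open LiftMor

/-! ### From algebras to lifting operations. -/

section

variable {X Y X' Y' Z : C}

/-- The structure map of an algebra. -/
def str (p : (awfs F).RAlg X Y) : (F p.f).E ⟶ X := p.s

/-- This and the next two are the algebra laws expressed through `F`; they hold by unfolding `awfs`.
-/
theorem l_str (p : (awfs F).RAlg X Y) : (F p.f).l ≫ str p = 𝟙 X := p.l_s

theorem str_f (p : (awfs F).RAlg X Y) : str p ≫ p.f = (F p.f).q.f := p.s_f

theorem mul_str (p : (awfs F).RAlg X Y) (w : str p ≫ p.f = (F p.f).q.f ≫ 𝟙 Y) :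
    mul F p.f ≫ str p = map F (F p.f).q.f p.f (str p) (𝟙 Y) w ≫ str p := p.μ_s w

theorem lift_e (p : (awfs F).RAlg X Y) {A B : J.Obj} {j : J.Ver A B} {x : U.ob A ⟶ X}
    {y : U.ob B ⟶ Y} (e : x ≫ p.f = U.vmor j ≫ y) :
    (x ≫ (F p.f).l) ≫ (F p.f).q.f = U.vmor j ≫ y := by
  rw [Category.assoc, (F p.f).fac, e]

/-- The lifting operation on the underlying map of an algebra. -/
def algLift (p : (awfs F).RAlg X Y) {A B : J.Obj} (j : J.Ver A B) (x : U.ob A ⟶ X)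
    (y : U.ob B ⟶ Y) (e : x ≫ p.f = U.vmor j ≫ y) : U.ob B ⟶ X :=
  (F p.f).q.lift j (x ≫ (F p.f).l) y (lift_e p e) ≫ str p

theorem algLift_congr (p : (awfs F).RAlg X Y) {A B : J.Obj} (j : J.Ver A B)
    {x x' : U.ob A ⟶ X} {y y' : U.ob B ⟶ Y} (hx : x = x') (hy : y = y')
    (e : x ≫ p.f = U.vmor j ≫ y) (e' : x' ≫ p.f = U.vmor j ≫ y') :
    algLift p j x y e = algLift p j x' y' e' := by
  subst hx hy
  rfl

/-- The structure map of an algebra is compatible with the lifting operations. -/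
theorem lift_str (p : (awfs F).RAlg X Y) {A B : J.Obj} (j : J.Ver A B) (x : U.ob A ⟶ (F p.f).E)
    (y : U.ob B ⟶ Y) (e : x ≫ (F p.f).q.f = U.vmor j ≫ y)
    (e' : (x ≫ str p) ≫ p.f = U.vmor j ≫ y) :
    (F p.f).q.lift j x y e ≫ str p = algLift p j (x ≫ str p) y e' := by
  have w : str p ≫ p.f = (F p.f).q.f ≫ 𝟙 Y := (str_f p).trans (Category.comp_id _).symm
  have e₁ : (x ≫ (F (F p.f).q.f).l) ≫ (F (F p.f).q.f).q.f = U.vmor j ≫ y := by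
    rw [Category.assoc, (F (F p.f).q.f).fac, e]
  -- The same filler, formed one level up in the free structure on `R(p.f)`, is sent by `mul` to the
  -- original filler and by the functorial action of `str p` to the filler for `x ≫ str p`.
  -- Associativity of the algebra equates the two after `str p`.
  have h₁ : (F (F p.f).q.f).q.lift j (x ≫ (F (F p.f).q.f).l) y e₁ ≫ mul F p.f =
      (F p.f).q.lift j x y e := by
    have e₂ : ((x ≫ (F (F p.f).q.f).l) ≫ mul F p.f) ≫ (F p.f).q.f = U.vmor j ≫ y ≫ 𝟙 Y := by
      rw [Category.assoc x, l_mul, Category.comp_id, Category.comp_id, e]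
    rw [(mul_isSquare F p.f).lift_comp j _ _ e₁ e₂]
    exact (F p.f).q.lift_congr _ (by rw [Category.assoc, l_mul, Category.comp_id])
      (Category.comp_id y) _ _
  have h₂ : (F (F p.f).q.f).q.lift j (x ≫ (F (F p.f).q.f).l) y e₁ ≫
      map F (F p.f).q.f p.f (str p) (𝟙 Y) w =
        (F p.f).q.lift j ((x ≫ str p) ≫ (F p.f).l) y (lift_e p e') := by
    have hx : (x ≫ (F (F p.f).q.f).l) ≫ map F (F p.f).q.f p.f (str p) (𝟙 Y) w =
        (x ≫ str p) ≫ (F p.f).l := by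
      rw [Category.assoc, l_map, Category.assoc]
    have e₂ : ((x ≫ (F (F p.f).q.f).l) ≫ map F (F p.f).q.f p.f (str p) (𝟙 Y) w) ≫
        (F p.f).q.f = U.vmor j ≫ y ≫ 𝟙 Y := by
      rw [hx, lift_e p e', Category.comp_id]
    rw [(map_isSquare F _ _ _ _ w).lift_comp j _ _ e₁ e₂]
    exact (F p.f).q.lift_congr _ hx (Category.comp_id y) _ _
  rw [algLift, ← h₂, ← h₁, Category.assoc, Category.assoc, mul_str]

/-- The underlying map of an algebra with its lifting operation. -/
def toLiftMor (p : (awfs F).RAlg X Y) : LiftMor U X Y where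
  f := p.f
  lift j x y e := algLift p j x y e
  left_fac j x y e := by
    rw [algLift, ← Category.assoc, (F p.f).q.left_fac, Category.assoc, l_str, Category.comp_id]
  right_fac j x y e := by rw [algLift, Category.assoc, str_f, (F p.f).q.right_fac]
  horizontal {A B A' B' t i j b} α x y e e' := by
    rw [algLift, algLift, ← Category.assoc]
    congr 1
    rw [← (F p.f).q.horizontal α]
    · exact (F p.f).q.lift_congr _ (Category.assoc _ _ _) rfl _ _
    · rw [← lift_e p e', Category.assoc (U.hmor t), Category.assoc (U.hmor t) x, Category.assoc,
        Category.assoc, Category.assoc]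
  vertical {A B D} i j x y e e₁ e₂ := by
    have h₁ := lift_e p e₁
    -- The second problem starts at a filler followed by `str p`. Pulling `str p` out leaves an
    -- iterated filler in the free structure, whose vertical law applies.
    have h := lift_str p j _ y ((F p.f).q.right_fac i _ _ h₁) e₂
    refine h.symm.trans (congrArg (· ≫ str p) ?_)
    exact (F p.f).q.vertical i j _ y (lift_e p e) h₁ _

theorem str_isSquare (p : (awfs F).RAlg X Y) :
    IsSquare (str p) (F p.f).q (toLiftMor p) (𝟙 Y) where
  comm := (str_f p).trans (Category.comp_id _).symm
  lift_comp j x y e e' := by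
    have e'' : (x ≫ str p) ≫ p.f = U.vmor j ≫ y := by
      rw [Category.assoc, str_f, e]
    exact (lift_str p j x y e e'').trans (algLift_congr p j rfl (Category.comp_id y).symm e'' e')

/-- The lifting operation of an algebra is the only one with which its structure map is
compatible. -/
theorem toLiftMor_eq (p : (awfs F).RAlg X Y) (m : LiftMor U X Y) (hf : p.f = m.f)
    (hm : IsSquare (str p) (F p.f).q m (𝟙 Y)) : toLiftMor p = m := by
  refine LiftMor.ext' hf fun j x y e e' => ?_
  -- Since `str p` retracts `l`, every problem against `p.f` is the image of one in the free
  -- structure, so compatibility determines its filler.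
  have hx : (x ≫ (F p.f).l) ≫ str p = x := by rw [Category.assoc, l_str, Category.comp_id]
  have e₂ : ((x ≫ (F p.f).l) ≫ str p) ≫ m.f = U.vmor j ≫ y ≫ 𝟙 Y := by
    rw [hx, e', Category.comp_id]
  refine (hm.lift_comp j _ _ (lift_e p e) e₂).trans ?_
  exact m.lift_congr _ hx (Category.comp_id y) _ _

/-! ### From lifting operations to algebras. -/

variable (F) in
/-- The structure map of the algebra of a morphism with a lifting operation. -/
def strOf (m : LiftMor U X Y) : (F m.f).E ⟶ X :=
  (F m.f).lift m (𝟙 X) (𝟙 Y) (by rw [Category.id_comp, Category.comp_id])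

theorem l_strOf (m : LiftMor U X Y) : (F m.f).l ≫ strOf F m = 𝟙 X := (F m.f).l_lift _ _ _ _

theorem strOf_isSquare (m : LiftMor U X Y) : IsSquare (strOf F m) (F m.f).q m (𝟙 Y) :=
  (F m.f).lift_isSquare _ _ _ _

theorem strOf_f (m : LiftMor U X Y) : strOf F m ≫ m.f = (F m.f).q.f :=
  (strOf_isSquare m).comm.trans (Category.comp_id _)

theorem mul_strOf (m : LiftMor U X Y) : mul F m.f ≫ strOf F m =
    map F (F m.f).q.f m.f (strOf F m) (𝟙 Y) (strOf_isSquare m).comm ≫ strOf F m :=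
  hom_ext ((mul_isSquare F m.f).hcomp_id (strOf_isSquare m))
    ((map_isSquare F _ _ _ _ _).hcomp_id (strOf_isSquare m))
    (by rw [l_mul_assoc, l_map_assoc, l_strOf, Category.comp_id])

variable (F) in
/-- The algebra of a morphism with a lifting operation. -/
def ofLiftMor (m : LiftMor U X Y) : (awfs F).RAlg X Y :=
  PreAWFS.RAlg.ofS (W := preAWFS F) m.f (strOf F m) (l_strOf m) (strOf_f m) (mul_strOf m)

theorem toLiftMor_ofLiftMor (m : LiftMor U X Y) : toLiftMor (ofLiftMor F m) = m :=
  toLiftMor_eq (ofLiftMor F m) m rfl (strOf_isSquare m)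

theorem ofLiftMor_toLiftMor (p : (awfs F).RAlg X Y) : ofLiftMor F (toLiftMor p) = p := by
  -- Both structure maps retract `l` and are compatible with the same operation, so freeness
  -- identifies them.
  have h : strOf F (toLiftMor p) = str p :=
    hom_ext (strOf_isSquare (toLiftMor p)) (str_isSquare p)
      ((l_strOf (toLiftMor p)).trans (l_str p).symm)
  refine PreAWFS.RAlg.ext' rfl ?_
  refine Eq.trans ?_ (congrArg (· ≫ p.s) (PreAWFS.map_id (W := preAWFS F) p.f
    ((Category.id_comp _).trans (Category.comp_id _).symm)).symm)
  exact h.trans (Category.id_comp _).symm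

/-! ### Compatibility with identities, vertical composites and squares. -/

theorem toLiftMor_vid (X : C) :
    toLiftMor (PreAWFS.RAlg.vid (awfs F).toPreAWFS X) = LiftMor.vid U X :=
  toLiftMor_eq _ _ rfl (IsSquare.toVid (F (𝟙 X)).q)

/-- The lift used in the composition of algebras. -/
theorem compW_isSquare (p : (awfs F).RAlg X Y) (q : (awfs F).RAlg Y Z) :
    IsSquare (AWFS.compW p q) (F (p.f ≫ q.f)).q (toLiftMor q) (𝟙 Z) :=
  (map_isSquare F _ _ _ _ (Category.comp_id _).symm).hcomp_id (str_isSquare q)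

theorem toLiftMor_vcomp (p : (awfs F).RAlg X Y) (q : (awfs F).RAlg Y Z) :
    toLiftMor (AWFS.vcomp p q) = (toLiftMor p).vcomp (toLiftMor q) := by
  refine toLiftMor_eq _ _ rfl ?_
  -- The structure map of the composite algebra is `comul`, then `map`, then `str p`. The first is a
  -- square into a vertical composite of free structures; the other two form a square over `compW`,
  -- which is a square into `toLiftMor q`.
  exact (comul_isSquare F (p.f ≫ q.f)).hcomp_id
    (((map_isSquare F (F (p.f ≫ q.f)).l p.f (𝟙 X) (AWFS.compW p q)
      ((Category.id_comp _).trans (AWFS.l_compW p q).symm)).hcomp_id (str_isSquare p)).vcomp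
        (compW_isSquare p q))

theorem isSquare_toLiftMor {a : X ⟶ X'} {b : Y ⟶ Y'} {p : (awfs F).RAlg X Y}
    {q : (awfs F).RAlg X' Y'} (α : PreAWFS.RAlg.IsSquare a p q b) :
    IsSquare a (toLiftMor p) (toLiftMor q) b := by
  obtain ⟨w, hw⟩ := PreAWFS.RAlg.isSquare_iff.1 α
  have hw' : map F p.f q.f a b w ≫ str q = str p ≫ a := hw
  refine ⟨w, fun j x y e e' => ?_⟩
  -- As a pasted square, `map ≫ str q` is compatible with the operations; being a morphism of
  -- algebras turns it into `str p ≫ a`, and restriction along `l` gives the claim.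
  have hα := (map_isSquare F p.f q.f a b w).hcomp_id (str_isSquare q)
  rw [hw'] at hα
  have hx : (x ≫ (F p.f).l) ≫ str p ≫ a = x ≫ a := by
    rw [Category.assoc, ← Category.assoc (F p.f).l, l_str, Category.id_comp]
  refine (Category.assoc _ _ _).trans ?_
  refine (hα.lift_comp j _ _ (lift_e p e) (by rw [hx, e'])).trans ?_
  exact (toLiftMor q).lift_congr _ hx rfl _ _

theorem isSquare_ofLiftMor {a : X ⟶ X'} {b : Y ⟶ Y'} {m : LiftMor U X Y} {n : LiftMor U X' Y'}
    (α : IsSquare a m n b) : PreAWFS.RAlg.IsSquare a (ofLiftMor F m) (ofLiftMor F n) b := by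
  have h : map F m.f n.f a b α.comm ≫ strOf F n = strOf F m ≫ a :=
    hom_ext ((map_isSquare F m.f n.f a b α.comm).hcomp_id (strOf_isSquare n))
      ((strOf_isSquare m).id_hcomp α)
      (by rw [l_map_assoc, l_strOf, Category.comp_id, ← Category.assoc, l_strOf, Category.id_comp])
  exact PreAWFS.RAlg.isSquare_iff.2 ⟨α.comm, h⟩

/-- The inverse of a bijection that preserves composition preserves it too. -/
theorem ofLiftMor_vcomp (m : LiftMor U X Y) (n : LiftMor U Y Z) :
    ofLiftMor F (m.vcomp n) = AWFS.vcomp (ofLiftMor F m) (ofLiftMor F n) := by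
  rw [← ofLiftMor_toLiftMor (AWFS.vcomp (ofLiftMor F m) (ofLiftMor F n)), toLiftMor_vcomp,
    toLiftMor_ofLiftMor, toLiftMor_ofLiftMor]

end

/-! ### The isomorphism of double categories over `Sq(C)`. -/

variable (F)

/-- The double functor from algebras to morphisms with a lifting operation. -/
def algToLift : DoubleFunctor (algDouble (awfs F)) (liftDouble U) where
  obj X := X
  hor f := f
  ver p := toLiftMor p
  sq α := isSquare_toLiftMor α
  hor_id _ := rfl
  hor_comp _ _ := rfl
  ver_vid X := toLiftMor_vid X
  ver_vcomp p q := toLiftMor_vcomp p q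
  sq_hid _ := proof_irrel_heq _ _
  sq_vid _ := proof_irrel_heq _ _
  sq_hcomp _ _ := proof_irrel_heq _ _
  sq_vcomp _ _ := proof_irrel_heq _ _

/-- The double functor from morphisms with a lifting operation to algebras. -/
def liftToAlg : DoubleFunctor (liftDouble U) (algDouble (awfs F)) where
  obj X := X
  hor f := f
  ver m := ofLiftMor F m
  sq α := isSquare_ofLiftMor α
  hor_id _ := rfl
  hor_comp _ _ := rfl
  ver_vid X := (congrArg (ofLiftMor F) (toLiftMor_vid (F := F) X)).symm.trans
    (ofLiftMor_toLiftMor _)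
  ver_vcomp m n := ofLiftMor_vcomp m n
  sq_hid _ := proof_irrel_heq _ _
  sq_vid _ := proof_irrel_heq _ _
  sq_hcomp _ _ := proof_irrel_heq _ _
  sq_vcomp _ _ := proof_irrel_heq _ _

/-- The algebras of the algebraic weak factorisation system of free lifting structures are the
morphisms with a lifting operation. -/
theorem cofibrantlyGeneratedBy_awfs : (awfs F).CofibrantlyGeneratedBy U := by
  refine ⟨algToLift F, liftToAlg F, ?_, ?_, rfl⟩
  -- Objects and horizontal arrows are untouched and squares are propositions, so only vertical
  -- arrows need an argument.
  · refine DoubleFunctor.ext rfl HEq.rfl (heq_of_eq ?_) (proof_irrel_heq _ _)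
    funext X Y p
    exact ofLiftMor_toLiftMor p
  · refine DoubleFunctor.ext rfl HEq.rfl (heq_of_eq ?_) (proof_irrel_heq _ _)
    funext X Y m
    exact toLiftMor_ofLiftMor m

end FreeLift

end AlgebraLift

theorem theorem4p9 {C : Type u} [Category.{v} C] [Limits.HasColimits C]
    (J : DoubleCat.{v, v, v, v + 1}) (U : DoubleFunctor J (sqDouble C))
    (hU : ∀ A : J.Obj, IsOmegaSmall (U.ob A)) :
    ∃ W : AWFS C, W.CofibrantlyGeneratedBy U :=
  ⟨FreeLift.awfs fun _ _ f => freeLift hU f, FreeLift.cofibrantlyGeneratedBy_awfs _⟩
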